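/- Let $A$ be either the algebra $\mathbb H$ of quaternions or the algebra $\mathbb O$ of octonions, with conjugation $x\mapsto x^c$, trace $t(x)=x+x^c$, squared norm $n(x)=xx^c=\|x\|^2$, and set of imaginary units $\mathbb S_A=\{I\in A: I^2=-1\}$. For $y=\alpha+\beta I\in A$ ($\alpha,\beta\in\mathbb R$, $I\in\mathbb S_A$) put $\mathbb S_y=\alpha+\beta\,\mathbb S_A$ (so $\mathbb S_y=\{y\}$ if $y\in\mathbb R$, and otherwise $\mathbb S_y$ is a sphere of dimension $\dim_{\mathbb R}A-2$ with centre on the real axis). For $D\subset\mathbb C$ put $\Omega_D=\{\alpha+\beta I:\alpha+\iota\beta\in D,\ I\in\mathbb S_A\}$; sets of this form are called circular. *Slice regular and slice-Nash functions.* Let $D\subset\mathbb C$ be non-empty, open and invariant under conjugation. A stem function on $D$ is a map $F=F_1+\iota F_2:D\to A\otimes_{\mathbb R}\mathbb C$ with $F_1(\bar z)=F_1(z)$, $F_2(\bar z)=-F_2(z)$; it induces the function $f:\Omega_D\to A$, $f(\alpha+\beta I)=F_1(\alpha+\iota\beta)+I\,F_2(\alpha+\iota\beta)$. The function $f$ is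 slice regular if $F$ is of class $C^1$ and satisfies $\partial F/\partial\alpha+\iota\,\partial F/\partial\beta=0$. It is slice-Nash if, moreover, for some $I\in\mathbb S_A$ and some real basis of $A$ of the form $\{1,I,I_1,II_1,\dots,I_u,II_u\}$, all the complex-valued components of $F$ with respect to this basis are complex Nash functions on $D$, i.e. are, near each point of $D$, holomorphic functions $g$ with $P(z,g(z))=0$ for some non-zero $P\in\mathbb C[z,t]$. *Singularities.* Let $U$ be an open circular set, $y\in U$, and $f$ slice regular on $U\setminus\mathbb S_y$. Put $\delta_y(x)=x-y$ if $y\in\mathbb R$ and $\delta_y(x)=x^2-x\,t(y)+n(y)$ otherwise. Then $\mathbb S_y$ is a removable singularity of $f$ if $f$ is the restriction of a slice regular function on $U$; it is a pole of $f$ (real if $y\in\mathbb R$, spherical otherwise) if it is not removable and, for some integer $k\ge1$, the function $\delta_y^kf$ is the restriction of a slice regular function on $U$; it is an essential singularity if $\sup_{x\in V\setminus\mathbb S_y}\|\delta_y(x)^kf(x)\|=+\infty$ for all open $V$ with $\mathbb S_y\subset V\subset U$ and all integers $k\ge0$. A discrete set of singularities of an open circular set $\Omega$ is a relatively closed subset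 $\Omega_0\subset\Omega$ which is a union of sets $\mathbb S_y$ (points of the real axis, or spheres), each of them isolated in $\Omega_0$. For a slice regular function on $\Omega\setminus\Omega_0$ and $y\in\Omega_0$, the type of the singularity $\mathbb S_y$ is defined with $U=(\Omega\setminus\Omega_0)\cup\mathbb S_y$. Such a function is called semiregular on $\Omega$ if $\mathbb S_y$ is a removable singularity or a pole for every $y\in\Omega_0$. **Statement.** Let $\Omega\subset A$ be an open circular set, $\Omega_0\subset\Omega$ a discrete set of singularities, and $f:\Omega\setminus\Omega_0\to A$ a slice-Nash function. Then: 1. $f$ is semiregular on $\Omega$, and none of the singularities $\mathbb S_y$, $y\in\Omega_0$, is essential. 2. If $\Omega$ is connected, there exist finitely many (possibly no) real points $q_1,\dots,q_k\in\Omega_0\cap\mathbb R$, finitely many (possibly no) spheres $\mathbb S_{x_1},\dots,\mathbb S_{x_r}\subset\Omega_0$ with $x_1,\dots,x_r\notin\mathbb R$, and, writing $\Omega_1=\{q_1,\dots,q_k\}\cup\mathbb S_{x_1}\cup\dots\cup\mathbb S_{x_r}$, a slice-Nash function $\Phi:\Omega\setminus\Omega_1\to A$ which is semiregular on $\Omega$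 and satisfies $f=\Phi|_{\Omega\setminus\Omega_0}$. 3. If $\Omega$ is connected, the set of poles of $f$ (the union of those $\mathbb S_y\subset\Omega_0$ that are poles of $f$) is the union of finitely many points of the real axis and finitely many spheres $\mathbb S_x$ with $x\notin\mathbb R$. -/

import Mathlib

open scoped Quaternion

noncomputable section

namespace SliceNash

/-! ### Octonions -/

/-- The octonions `ℍ ⊕ ℓ ℍ`, with the Euclidean norm of `ℝ⁸`. -/
def Octonion : Type := WithLp 2 (ℍ[ℝ] × ℍ[ℝ])

namespace Octonion

instance : NormedAddCommGroup Octonion :=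
  inferInstanceAs (NormedAddCommGroup (WithLp 2 (ℍ[ℝ] × ℍ[ℝ])))

instance : NormedSpace ℝ Octonion :=
  inferInstanceAs (NormedSpace ℝ (WithLp 2 (ℍ[ℝ] × ℍ[ℝ])))

/-- The octonion `a + ℓ b`. -/
def mk (a b : ℍ[ℝ]) : Octonion := WithLp.toLp 2 (a, b)

/-- The component `a` of `a + ℓ b`. -/
def fst (x : Octonion) : ℍ[ℝ] := (WithLp.ofLp x).1

/-- The component `b` of `a + ℓ b`. -/
def snd (x : Octonion) : ℍ[ℝ] := (WithLp.ofLp x).2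

instance : One Octonion := ⟨mk 1 0⟩

/-- Cayley-Dickson product: `(α + ℓ β) (γ + ℓ δ) = (α γ - δ βᶜ) + ℓ (αᶜ δ + γ β)`. -/
instance : Mul Octonion :=
  ⟨fun x y => mk (x.fst * y.fst - y.snd * star x.snd) (star x.fst * y.snd + y.fst * x.snd)⟩

instance : Star Octonion := ⟨fun x => mk (star x.fst) (-x.snd)⟩

end Octonion

/-! ### The algebra `A`: quaternions or octonions -/

/-- `e : A → B` respects the product, the unit and the conjugation. -/
def RespectsStarAlgebra {A B : Type*} [Mul A] [One A] [Star A] [Mul B] [One B] [Star B]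
    (e : A → B) : Prop :=
  e 1 = 1 ∧ (∀ x y, e (x * y) = e x * e y) ∧ ∀ x, e (star x) = star (e x)

/-- `A` is (a copy of) the normed real `*`-algebra `ℍ` or the normed real `*`-algebra `𝕆`. -/
def IsQuaternionsOrOctonions (A : Type*) [NormedAddCommGroup A] [NormedSpace ℝ A]
    [Mul A] [One A] [Star A] : Prop :=
  (∃ e : A ≃ₗᵢ[ℝ] ℍ[ℝ], RespectsStarAlgebra e) ∨
    (∃ e : A ≃ₗᵢ[ℝ] Octonion, RespectsStarAlgebra e)

section Defs

variable {A : Type*} [NormedAddCommGroup A] [NormedSpace ℝ A] [Mul A] [One A] [Star A]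

/-! ### Slices and circular sets -/

variable (A) in
/-- The sphere `𝕊_A` of imaginary units. -/
def imUnits : Set A := {I | I * I = -1}

/-- The map `φ_I : α + ι β ↦ α + β I`. -/
def phi (I : A) (z : ℂ) : A := z.re • (1 : A) + z.im • I

/-- The circularised `Ω_D` of `D ⊆ ℂ`. -/
def circularised (D : Set ℂ) : Set A := {x | ∃ I ∈ imUnits A, ∃ z ∈ D, x = phi I z}

/-- `U` is a circular set. -/
def IsCircular (U : Set A) : Prop := ∃ D : Set ℂ, U = circularised D

/-- `x` lies on the real axis of `A`. -/
def IsRealPoint (x : A) : Prop := ∃ r : ℝ, x = r • (1 : A)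

/-- The set `𝕊_y = α + β 𝕊_A` for `y = α + β I`: a point if `y` is real, and otherwise a sphere
of codimension two centred on the real axis. -/
def sph (y : A) : Set A :=
  {x | ∃ z : ℂ, (∃ I ∈ imUnits A, y = phi I z) ∧ ∃ J ∈ imUnits A, x = phi J z}

/-! ### Stem functions, slice functions and slice regular functions

An element `x + ι y` of `A ⊗ ℂ` is the pair `(x, y)`. -/

/-- Domains of stem functions: non-empty, open, symmetric with respect to the real axis. -/
def IsStemDomain (D : Set ℂ) : Prop :=
  D.Nonempty ∧ IsOpen D ∧ ∀ z ∈ D, starRingEnd ℂ z ∈ D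

/-- `F = F₁ + ι F₂` is a stem function on `D`. -/
def IsStem (D : Set ℂ) (F : ℂ → A × A) : Prop :=
  ∀ z ∈ D, (F (starRingEnd ℂ z)).1 = (F z).1 ∧ (F (starRingEnd ℂ z)).2 = -(F z).2

/-- `f` coincides on `Ω_D` with the slice function `𝓘(F)` induced by `F`. -/
def Induces (D : Set ℂ) (F : ℂ → A × A) (f : A → A) : Prop :=
  ∀ I ∈ imUnits A, ∀ z ∈ D, f (phi I z) = (F z).1 + I * (F z).2

/-- `F` is of class `C¹` on `D` and satisfies the Cauchy-Riemann equations there. -/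
def IsHolomorphicStem (D : Set ℂ) (F : ℂ → A × A) : Prop :=
  ContDiffOn ℝ 1 F D ∧ ∀ z ∈ D,
    fderiv ℝ (fun w => (F w).1) z 1 = fderiv ℝ (fun w => (F w).2) z Complex.I ∧
    fderiv ℝ (fun w => (F w).1) z Complex.I = -fderiv ℝ (fun w => (F w).2) z 1

/-- `f ∈ 𝓢𝓡_A(U)`: the restriction of `f` to `U` is slice regular. -/
def IsSliceRegularOn (U : Set A) (f : A → A) : Prop :=
  ∃ (D : Set ℂ) (F : ℂ → A × A), IsStemDomain D ∧ U = circularised D ∧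
    IsStem D F ∧ Induces D F f ∧ IsHolomorphicStem D F

/-! ### Nash functions -/

/-- `g` is a complex Nash function on the open set `D`. -/
def IsComplexNashOn (D : Set ℂ) (g : ℂ → ℂ) : Prop :=
  ∀ z₀ ∈ D, ∃ U : Set ℂ, IsOpen U ∧ z₀ ∈ U ∧ U ⊆ D ∧ AnalyticOnNhd ℂ g U ∧
    ∃ P : Polynomial (Polynomial ℂ), P ≠ 0 ∧ ∀ z ∈ U, P.evalEval z (g z) = 0

/-- `b` is a splitting base `{1, I, I₁, I I₁, …, I_u, I I_u}` associated to `I`: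
`b (k, 0)` is `I_k`, with `I₀ = 1`, and `b (k, 1)` is `I I_k`. -/
def IsSplittingBase {u : ℕ} (I : A) (b : Module.Basis (Fin (u + 1) × Fin 2) ℝ A) : Prop :=
  b (0, 0) = 1 ∧ ∀ k, b (k, 1) = I * b (k, 0)

/-- The complex component of `F = F₁ + ι F₂` along a vector of the real base `b`. -/
def component {κ : Type*} (b : Module.Basis κ ℝ A) (F : ℂ → A × A) (j : κ) (z : ℂ) : ℂ :=
  ⟨b.repr (F z).1 j, b.repr (F z).2 j⟩

/-- `F` is a stem-Nash function on `D`. -/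
def IsStemNash (D : Set ℂ) (F : ℂ → A × A) : Prop :=
  ∃ I ∈ imUnits A, ∃ (u : ℕ) (b : Module.Basis (Fin (u + 1) × Fin 2) ℝ A),
    IsSplittingBase I b ∧ ∀ j, IsComplexNashOn D (component b F j)

/-- `f ∈ 𝓢𝓝_A(U)`: the restriction of `f` to `U` is a slice-Nash function. -/
def IsSliceNashOn (U : Set A) (f : A → A) : Prop :=
  ∃ (D : Set ℂ) (F : ℂ → A × A), IsStemDomain D ∧ U = circularised D ∧
    IsStem D F ∧ Induces D F f ∧ IsHolomorphicStem D F ∧ IsStemNash D F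

/-! ### Singularities

In the next four definitions `U` is an open circular set that contains `𝕊_y`, and `f` is
considered on `U \ 𝕊_y`. -/

open Classical in
/-- `x - y` if `y` is real, and `Δ_y(x) = x² - x t(y) + n(y)` otherwise. -/
def singFactor (y x : A) : A :=
  if IsRealPoint y then x - y else x * x - x * (y + star y) + y * star y

/-- `𝕊_y` is a removable singularity of `f`. -/
def IsRemovable (U : Set A) (y : A) (f : A → A) : Prop :=
  ∃ Φ : A → A, IsSliceRegularOn U Φ ∧ ∀ x ∈ U \ sph y, f x = Φ x

/-- `𝕊_y` is a pole (a spherical pole if `y` is not real) of `f`. -/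
def IsPole (U : Set A) (y : A) (f : A → A) : Prop :=
  ¬ IsRemovable U y f ∧ ∃ k : ℕ, 1 ≤ k ∧ ∃ Φ : A → A, IsSliceRegularOn U Φ ∧
    ∀ x ∈ U \ sph y, Φ x = npowRec k (singFactor y x) * f x

/-- `𝕊_y` is an essential singularity of `f`. -/
def IsEssential (U : Set A) (y : A) (f : A → A) : Prop :=
  ∀ V : Set A, IsOpen V → sph y ⊆ V → V ⊆ U → ∀ k : ℕ,
    ¬ BddAbove ((fun x => ‖npowRec k (singFactor y x) * f x‖) '' (V \ sph y))

/-- `Ω₀` is a discrete set of singularities in `Ω`: a relatively closed subset which is a union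
of isolated real points and isolated spheres `𝕊_y`. -/
def IsDiscreteSingSet (Ω Ω₀ : Set A) : Prop :=
  Ω₀ ⊆ Ω ∧ (∃ C : Set A, IsClosed C ∧ Ω₀ = Ω ∩ C) ∧
    ∀ y ∈ Ω₀, sph y ⊆ Ω₀ ∧ ∃ V : Set A, IsOpen V ∧ V ∩ Ω₀ = sph y

/-- For `y ∈ Ω₀`, the open circular set `(Ω \ Ω₀) ∪ 𝕊_y`, on which `𝕊_y` is the only
singularity of a function defined on `Ω \ Ω₀`. -/
def aroundSing (Ω Ω₀ : Set A) (y : A) : Set A := (Ω \ Ω₀) ∪ sph y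

/-- `f`, defined on `Ω \ Ω₀`, is a semiregular slice function on `Ω`. -/
def IsSemiregular (Ω Ω₀ : Set A) (f : A → A) : Prop :=
  IsDiscreteSingSet Ω Ω₀ ∧ IsSliceRegularOn (Ω \ Ω₀) f ∧
    ∀ y ∈ Ω₀, IsRemovable (aroundSing Ω Ω₀ y) y f ∨ IsPole (aroundSing Ω Ω₀ y) y f

/-- The set of poles of a function `f` defined on `Ω \ Ω₀`. -/
def poles (Ω Ω₀ : Set A) (f : A → A) : Set A := {y ∈ Ω₀ | IsPole (aroundSing Ω Ω₀ y) y f}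

/-- The union of the points of `Q` and of the spheres `𝕊_x`, `x ∈ X`. -/
def pointsAndSpheres (Q X : Finset A) : Set A := ↑Q ∪ ⋃ x ∈ X, sph x

end Defs

end SliceNash

end

/-! A slice-Nash function is determined by finitely many complex Nash functions, the components of
its stem function along a splitting base. The theorem thus reduces to one-variable facts about an
algebraic function `g` near an isolated singularity, transported between subsets of `ℂ` and circular
subsets of `A`.

Suppose `P(w, g(w)) = 0` near an isolated singularity `z`, with `P ≠ 0`. Cauchy's bound on roots
shows that `g` times the leading coefficient of `P` stays bounded near `z`
(`isBigO_leadingCoeff_mul`). The leading coefficient is a non-zero polynomial in `w`, so `(w - z) ^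
m * g` is bounded for some `m`, and `g` has at worst a pole. Riemann's extension theorem applied to
the components, after multiplication by a power of `singStem`, makes the product with `δ_y ^ k`
slice regular across `𝕊_y` (`exists_extension`, `exists_regular_mul`). This gives semiregularity,
and local boundedness of the extension excludes essential singularities.

For connected `Ω` the identity theorem propagates one relation `P` per component over the whole
domain, because punctured discs are connected (`eventually_evalEval_eq_zero`). Only zeros of the
finitely many leading coefficients, up to conjugation, can then fail to be removable. Filling in all
other singularities gives `Φ`, which satisfies the same relations and so remains Nash
(`exists_finite_extension`). -/

noncomputable section
namespace SliceNash

/-! ### Algebraic identities common to `ℍ` and `𝕆`. -/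

/-- The properties of the real `*`-algebras `ℍ` and `𝕆` on which the theory of slice functions
rests: `A` is alternative and quadratic, with real part `re`. -/
structure IsSliceAlgebra {A : Type*} [NormedAddCommGroup A] [NormedSpace ℝ A] [Mul A] [One A]
    [Star A] (re : A →ₗ[ℝ] ℝ) : Prop where
  add_mul : ∀ x y z : A, (x + y) * z = x * z + y * z
  mul_add : ∀ x y z : A, x * (y + z) = x * y + x * z
  smul_mul : ∀ (r : ℝ) (x y : A), (r • x) * y = r • (x * y)
  mul_smul : ∀ (r : ℝ) (x y : A), x * (r • y) = r • (x * y)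
  one_mul : ∀ x : A, 1 * x = x
  mul_one : ∀ x : A, x * 1 = x
  mul_mul_self : ∀ x y : A, x * (x * y) = (x * x) * y
  mul_self : ∀ x : A, x * x = (2 * re x) • x - (‖x‖ ^ 2) • (1 : A)
  star_eq : ∀ x : A, star x = (2 * re x) • (1 : A) - x
  norm_mul_le : ∀ x y : A, ‖x * y‖ ≤ 4 * ‖x‖ * ‖y‖
  re_one : re 1 = 1
  abs_re_le : ∀ x, |re x| ≤ ‖x‖

namespace Octonion

@[ext] theorem ext {x y : Octonion} (h₁ : x.fst = y.fst) (h₂ : x.snd = y.snd) : x = y :=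
  (WithLp.ofLp_injective 2) (Prod.ext h₁ h₂)

@[simp] theorem fst_add (x y : Octonion) : (x + y).fst = x.fst + y.fst := rfl
@[simp] theorem snd_add (x y : Octonion) : (x + y).snd = x.snd + y.snd := rfl
@[simp] theorem fst_sub (x y : Octonion) : (x - y).fst = x.fst - y.fst := rfl
@[simp] theorem snd_sub (x y : Octonion) : (x - y).snd = x.snd - y.snd := rfl
@[simp] theorem fst_neg (x : Octonion) : (-x).fst = -x.fst := rfl
@[simp] theorem snd_neg (x : Octonion) : (-x).snd = -x.snd := rfl
@[simp] theorem fst_smul (r : ℝ) (x : Octonion) : (r • x).fst = r • x.fst := rfl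
@[simp] theorem snd_smul (r : ℝ) (x : Octonion) : (r • x).snd = r • x.snd := rfl
@[simp] theorem fst_one : (1 : Octonion).fst = 1 := rfl
@[simp] theorem snd_one : (1 : Octonion).snd = 0 := rfl
@[simp] theorem fst_mul (x y : Octonion) :
    (x * y).fst = x.fst * y.fst - y.snd * star x.snd := rfl
@[simp] theorem snd_mul (x y : Octonion) :
    (x * y).snd = star x.fst * y.snd + y.fst * x.snd := rfl
@[simp] theorem fst_star (x : Octonion) : (star x).fst = star x.fst := rfl
@[simp] theorem snd_star (x : Octonion) : (star x).snd = -x.snd := rfl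
@[simp] theorem fst_mk (a b : ℍ[ℝ]) : (mk a b).fst = a := rfl
@[simp] theorem snd_mk (a b : ℍ[ℝ]) : (mk a b).snd = b := rfl

theorem norm_sq (x : Octonion) : ‖x‖ ^ 2 = ‖x.fst‖ ^ 2 + ‖x.snd‖ ^ 2 :=
  WithLp.prod_norm_sq_eq_of_L2 (α := ℍ[ℝ]) (β := ℍ[ℝ]) x

theorem norm_fst_le (x : Octonion) : ‖x.fst‖ ≤ ‖x‖ := by
  have := norm_sq x
  exact abs_le_of_sq_le_sq' (by nlinarith [sq_nonneg ‖x.snd‖]) (norm_nonneg _) |>.2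

theorem norm_snd_le (x : Octonion) : ‖x.snd‖ ≤ ‖x‖ := by
  have := norm_sq x
  exact abs_le_of_sq_le_sq' (by nlinarith [sq_nonneg ‖x.fst‖]) (norm_nonneg _) |>.2

theorem norm_le_add (x : Octonion) : ‖x‖ ≤ ‖x.fst‖ + ‖x.snd‖ := by
  have := norm_sq x
  exact abs_le_of_sq_le_sq' (by nlinarith [norm_nonneg x.fst, norm_nonneg x.snd])
    (by positivity) |>.2

/-- The real part of an octonion. -/
def reLin : Octonion →ₗ[ℝ] ℝ where
  toFun x := x.fst.re
  map_add' _ _ := rfl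
  map_smul' _ _ := rfl

@[simp] theorem reLin_apply (x : Octonion) : reLin x = x.fst.re := rfl

end Octonion

theorem Quaternion.norm_sq_eq (a : ℍ[ℝ]) :
    ‖a‖ ^ 2 = a.re ^ 2 + a.imI ^ 2 + a.imJ ^ 2 + a.imK ^ 2 := by
  rw [← Quaternion.normSq_def', Quaternion.normSq_eq_norm_mul_self, sq]

/-- Quaternions associate, so the only obstruction is the order of factors. Writing `star x.fst` as
a real number minus `x.fst`, and `x.snd * star x.snd` as a real number, leaves only central scalars
to move. -/
theorem Octonion.mul_mul_self (x y : Octonion) : x * (x * y) = (x * x) * y := by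
  have ha : star x.fst = ((2 * x.fst.re : ℝ) : ℍ[ℝ]) - x.fst := Quaternion.star_eq_two_re_sub _
  have hc := Quaternion.self_mul_star x.snd
  have hc' := Quaternion.star_mul_self x.snd
  have ca (q : ℍ[ℝ]) := (Quaternion.coe_commutes (2 * x.fst.re) q)
  have cn (q : ℍ[ℝ]) := (Quaternion.coe_commutes (Quaternion.normSq x.snd) q)
  apply Octonion.ext
  · simp only [fst_mul, snd_mul, star_add, star_mul, star_star, add_mul, mul_add, mul_sub, sub_mul,
      mul_assoc, hc, cn]
    simp only [ha, mul_sub, sub_mul, ca, mul_assoc]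
    abel
  · simp only [fst_mul, snd_mul, star_sub, star_mul, mul_add, sub_mul, mul_assoc, hc, hc',
      Quaternion.star_coe, cn]
    simp only [ha, sub_mul, mul_sub, ca, mul_assoc]
    abel

theorem Octonion.isSliceAlgebra : IsSliceAlgebra Octonion.reLin where
  add_mul x y z := by ext <;> simp <;> ring
  mul_add x y z := by ext <;> simp <;> ring
  smul_mul r x y := by ext <;> simp <;> ring
  mul_smul r x y := by ext <;> simp <;> ring
  one_mul x := by ext <;> simp
  mul_one x := by ext <;> simp
  mul_mul_self := Octonion.mul_mul_self
  mul_self x := by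
    rw [Octonion.norm_sq, Quaternion.norm_sq_eq, Quaternion.norm_sq_eq]
    ext <;> simp <;> ring
  star_eq x := by ext <;> simp; ring
  -- The constant 4 counts the quaternionic products in the two components, each at most `‖x‖ *
  -- ‖y‖`. Only continuity-type bounds are needed, so multiplicativity of the norm is not proved.
  norm_mul_le x y := by
    have h1 := norm_sub_le (x.fst * y.fst) (y.snd * star x.snd)
    have h2 := norm_add_le (star x.fst * y.snd) (y.fst * x.snd)
    have h3 := Octonion.norm_le_add (x * y)
    simp only [Octonion.fst_mul, Octonion.snd_mul, norm_mul, norm_star] at h1 h2 h3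
    have a1 := Octonion.norm_fst_le x
    have a2 := Octonion.norm_snd_le x
    have b1 := Octonion.norm_fst_le y
    have b2 := Octonion.norm_snd_le y
    have m1 := mul_le_mul a1 b1 (norm_nonneg _) (norm_nonneg _)
    have m2 := mul_le_mul b2 a2 (norm_nonneg _) (norm_nonneg _)
    have m3 := mul_le_mul a1 b2 (norm_nonneg _) (norm_nonneg _)
    have m4 := mul_le_mul b1 a2 (norm_nonneg _) (norm_nonneg _)
    linarith
  re_one := by simp
  abs_re_le x := by
    have h : |x.fst.re| ≤ ‖x.fst‖ := by
      apply abs_le_of_sq_le_sq _ (norm_nonneg _)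
      rw [Quaternion.norm_sq_eq]
      nlinarith [sq_nonneg x.fst.imI, sq_nonneg x.fst.imJ, sq_nonneg x.fst.imK]
    exact h.trans (Octonion.norm_fst_le x)

/-- All these properties are identities or norm inequalities, so they pass to isometrically embedded
subalgebras. Since `ℍ` embeds in `𝕆`, the octonions are the only case checked by hand. -/
theorem IsSliceAlgebra.comap {A B : Type*} [NormedAddCommGroup A] [NormedSpace ℝ A] [Mul A]
    [One A] [Star A] [NormedAddCommGroup B] [NormedSpace ℝ B] [Mul B] [One B] [Star B]
    {re : B →ₗ[ℝ] ℝ} (hB : IsSliceAlgebra re) (e : A →ₗᵢ[ℝ] B) (he : RespectsStarAlgebra e) :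
    IsSliceAlgebra (re ∘ₗ e.toLinearMap) := by
  obtain ⟨h1, hm, hs⟩ := he
  constructor
  · intro x y z; apply e.injective; simp [hm, hB.add_mul]
  · intro x y z; apply e.injective; simp [hm, hB.mul_add]
  · intro x y z; apply e.injective; simp [hm, hB.smul_mul]
  · intro x y z; apply e.injective; simp [hm, hB.mul_smul]
  · intro x; apply e.injective; simp [hm, h1, hB.one_mul]
  · intro x; apply e.injective; simp [hm, h1, hB.mul_one]
  · intro x y; apply e.injective; simp [hm, hB.mul_mul_self]
  · intro x; apply e.injective; simp [hm, h1, hB.mul_self (e x)]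
  · intro x; apply e.injective; simp [hs, h1, hB.star_eq]
  · intro x y
    have h := hB.norm_mul_le (e x) (e y)
    rwa [← hm, e.norm_map, e.norm_map, e.norm_map] at h
  · simp [h1, hB.re_one]
  · intro x; simpa using hB.abs_re_le (e x)

/-- The embedding of the quaternions into the octonions. -/
def Octonion.ofQuaternion : ℍ[ℝ] →ₗᵢ[ℝ] Octonion where
  toFun a := Octonion.mk a 0
  map_add' _ _ := by ext <;> simp
  map_smul' _ _ := by ext <;> simp
  norm_map' a := by
    have h := Octonion.norm_sq (Octonion.mk a 0)
    simp only [Octonion.fst_mk, Octonion.snd_mk, norm_zero, ne_eq, OfNat.ofNat_ne_zero,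
      not_false_eq_true, zero_pow, add_zero] at h
    exact (sq_eq_sq₀ (norm_nonneg _) (norm_nonneg _)).1 h

theorem Octonion.ofQuaternion_respects : RespectsStarAlgebra Octonion.ofQuaternion := by
  refine ⟨rfl, fun x y => ?_, fun x => ?_⟩
  · change Octonion.mk _ _ = Octonion.mk _ _ * Octonion.mk _ _
    ext <;> simp
  · change Octonion.mk _ _ = star (Octonion.mk _ _)
    ext <;> simp

theorem IsQuaternionsOrOctonions.exists_isSliceAlgebra {A : Type*} [NormedAddCommGroup A]
    [NormedSpace ℝ A] [Mul A] [One A] [Star A] (hA : IsQuaternionsOrOctonions A) :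
    (∃ re : A →ₗ[ℝ] ℝ, IsSliceAlgebra re) ∧ (imUnits A).Nonempty := by
  have key : ∃ a : ℍ[ℝ], a * a = -1 := ⟨((Complex.I : ℂ) : ℍ[ℝ]), by
    rw [← Quaternion.coeComplex_mul, Complex.I_mul_I]; ext <;> simp⟩
  obtain ⟨a, ha⟩ := key
  rcases hA with ⟨e, he⟩ | ⟨e, he⟩
  · refine ⟨⟨_, (Octonion.isSliceAlgebra.comap _ Octonion.ofQuaternion_respects).comap
      e.toLinearIsometry he⟩, e.symm a, ?_⟩
    apply e.injective
    simp [he.2.1, he.1, ha]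
  · refine ⟨⟨_, Octonion.isSliceAlgebra.comap e.toLinearIsometry he⟩,
      e.symm (Octonion.mk a 0), ?_⟩
    apply e.injective
    rw [he.2.1, map_neg, he.1, e.apply_symm_apply]
    apply Octonion.ext <;> simp [ha]

end SliceNash
end

/-! ### Slices, spheres and circular sets in terms of the closed upper half-plane. -/

noncomputable section
namespace SliceNash

open scoped ComplexConjugate

/-- The representative of `{z, conj z}` in the closed upper half-plane. -/
def upperRep (z : ℂ) : ℂ := ⟨z.re, |z.im|⟩

theorem upperRep_eq_or (z : ℂ) : upperRep z = z ∨ upperRep z = conj z := by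
  rcases abs_choice z.im with h | h
  · left; apply Complex.ext <;> simp [upperRep, h]
  · right; apply Complex.ext <;> simp [upperRep, h]

theorem upperRep_mem_iff {D : Set ℂ} (hD : ∀ z ∈ D, conj z ∈ D) {z : ℂ} :
    upperRep z ∈ D ↔ z ∈ D := by
  rcases upperRep_eq_or z with h | h <;> rw [h]
  exact ⟨fun hz => by simpa using hD _ hz, hD z⟩

theorem upperRep_of_nonneg {z : ℂ} (hz : 0 ≤ z.im) : upperRep z = z := by
  apply Complex.ext <;> simp [upperRep, abs_of_nonneg hz]

namespace IsSliceAlgebra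

variable {A : Type*} [NormedAddCommGroup A] [NormedSpace ℝ A] [Mul A] [One A] [Star A]
  {re : A →ₗ[ℝ] ℝ}

theorem zero_mul (h : IsSliceAlgebra re) (x : A) : 0 * x = 0 := by
  simpa using h.smul_mul 0 0 x

theorem mul_zero (h : IsSliceAlgebra re) (x : A) : x * 0 = 0 := by
  simpa using h.mul_smul 0 x 0

theorem neg_mul (h : IsSliceAlgebra re) (x y : A) : -x * y = -(x * y) := by
  simpa using h.smul_mul (-1) x y

theorem mul_neg (h : IsSliceAlgebra re) (x y : A) : x * -y = -(x * y) := by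
  simpa using h.mul_smul (-1) x y

theorem one_ne_zero (h : IsSliceAlgebra re) : (1 : A) ≠ 0 := by
  intro h0
  simpa [h0] using h.re_one

theorem smul_one_injective (h : IsSliceAlgebra re) {r s : ℝ} (hrs : r • (1 : A) = s • 1) :
    r = s := by
  simpa [h.re_one] using congrArg re hrs

theorem neg_mem_imUnits (h : IsSliceAlgebra re) {I : A} (hI : I ∈ imUnits A) :
    -I ∈ imUnits A := by
  change -I * -I = -1
  rw [h.neg_mul, h.mul_neg, neg_neg]
  exact hI

/-- Otherwise the quadratic equation of `I` would make `I` a real multiple of `1`, whose square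
cannot be `-1`. -/
theorem re_imUnit (h : IsSliceAlgebra re) {I : A} (hI : I ∈ imUnits A) : re I = 0 := by
  by_contra h0
  have h1 := h.mul_self I
  rw [show I * I = -1 from hI] at h1
  have h2 : I = ((‖I‖ ^ 2 - 1) / (2 * re I)) • (1 : A) := by
    rw [div_eq_inv_mul, SemigroupAction.mul_smul, eq_inv_smul_iff₀ (by positivity), sub_smul, one_smul,
      sub_eq_neg_add, h1]
    abel
  have h3 : I * I = -1 := hI
  rw [h2, h.smul_mul, h.one_mul, smul_smul, ← neg_one_smul ℝ] at h3
  nlinarith [h.smul_one_injective h3, mul_self_nonneg ((‖I‖ ^ 2 - 1) / (2 * re I))]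

theorem norm_imUnit (h : IsSliceAlgebra re) {I : A} (hI : I ∈ imUnits A) : ‖I‖ = 1 := by
  have h1 := h.mul_self I
  rw [show I * I = -1 from hI, h.re_imUnit hI, MulZeroClass.mul_zero, zero_smul, zero_sub,
    neg_inj] at h1
  have h2 : (1 : ℝ) = ‖I‖ ^ 2 := h.smul_one_injective (by rwa [one_smul])
  nlinarith [norm_nonneg I]

theorem imUnit_mul_mul (h : IsSliceAlgebra re) {I : A} (hI : I ∈ imUnits A) (v : A) :
    I * (I * v) = -v := by
  rw [h.mul_mul_self, show I * I = -1 from hI, h.neg_mul, h.one_mul]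

theorem mem_imUnits_of (h : IsSliceAlgebra re) {v : A} (h0 : re v = 0) (h1 : ‖v‖ = 1) :
    v ∈ imUnits A := by
  change v * v = -1
  rw [h.mul_self, h0, h1]; simp

theorem re_phi (h : IsSliceAlgebra re) {I : A} (hI : I ∈ imUnits A) (z : ℂ) :
    re (phi I z) = z.re := by
  simp [phi, h.re_one, h.re_imUnit hI]

variable (re) in
/-- The point `α + ι β` with `β ≥ 0` such that `x ∈ α + β 𝕊_A`. -/
def profile (x : A) : ℂ := ⟨re x, ‖x - re x • (1 : A)‖⟩

omit [Mul A] [Star A] in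
variable (re) in
theorem profile_im_nonneg (x : A) : 0 ≤ (profile re x).im := norm_nonneg _

omit [Mul A] [Star A] in
variable (re) in
@[simp] theorem upperRep_profile (x : A) : upperRep (profile re x) = profile re x :=
  upperRep_of_nonneg (profile_im_nonneg re x)

theorem phi_sub_re (h : IsSliceAlgebra re) {I : A} (hI : I ∈ imUnits A) (z : ℂ) :
    phi I z - re (phi I z) • (1 : A) = z.im • I := by
  rw [h.re_phi hI, phi]; abel

theorem profile_phi (h : IsSliceAlgebra re) {I : A} (hI : I ∈ imUnits A) (z : ℂ) :
    profile re (phi I z) = upperRep z := by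
  rw [profile, h.phi_sub_re hI, norm_smul, h.norm_imUnit hI, h.re_phi hI]
  simp [upperRep]

theorem profile_phi_of_nonneg (h : IsSliceAlgebra re) {I : A} (hI : I ∈ imUnits A) {z : ℂ}
    (hz : 0 ≤ z.im) : profile re (phi I z) = z := by
  rw [h.profile_phi hI, upperRep_of_nonneg hz]

theorem continuous_profile (h : IsSliceAlgebra re) : Continuous (profile re) := by
  have hre : Continuous re :=
    (re.mkContinuous 1 fun x => by simpa using h.abs_re_le x).continuous
  have : profile re = fun x => (re x : ℂ) + (‖x - re x • (1 : A)‖ : ℂ) * Complex.I := by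
    funext x; apply Complex.ext <;> simp [profile]
  rw [this]
  fun_prop

omit [Mul A] [Star A] in
theorem continuous_phi (I : A) : Continuous (phi I) := by
  unfold phi; fun_prop

theorem exists_eq_phi_profile (h : IsSliceAlgebra re) (hne : (imUnits A).Nonempty) (x : A) :
    ∃ J ∈ imUnits A, x = phi J (profile re x) := by
  by_cases h0 : x - re x • (1 : A) = 0
  · obtain ⟨J, hJ⟩ := hne
    refine ⟨J, hJ, ?_⟩
    simp only [phi, profile, h0, norm_zero, zero_smul, add_zero]
    exact sub_eq_zero.1 h0
  · have hn : ‖x - re x • (1 : A)‖ ≠ 0 := norm_ne_zero_iff.2 h0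
    refine ⟨‖x - re x • (1 : A)‖⁻¹ • (x - re x • (1 : A)), h.mem_imUnits_of ?_ ?_, ?_⟩
    · simp [h.re_one]
    · rw [norm_smul, norm_inv, norm_norm, inv_mul_cancel₀ hn]
    · simp only [phi, profile]
      rw [smul_inv_smul₀ hn]; abel

omit [Mul A] [Star A] in
theorem phi_conj (I : A) (z : ℂ) : phi I (conj z) = phi (-I) z := by
  simp [phi]

omit [Mul A] [Star A] in
theorem phi_ofReal (I : A) (r : ℝ) : phi I (r : ℂ) = r • (1 : A) := by
  simp [phi]

/-- Multiplying by `phi I p` on the left corresponds to multiplying the stem `v + ι w` by the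
complex number `p`. The only non-trivial product is `I * (I * w)`, so alternativity replaces
associativity. -/
theorem phi_mul_induced (h : IsSliceAlgebra re) {I : A} (hI : I ∈ imUnits A) (p : ℂ) (v w : A) :
    phi I p * (v + I * w) = (p.re • v - p.im • w) + I * (p.im • v + p.re • w) := by
  simp only [phi, h.add_mul, h.mul_add, h.smul_mul, h.mul_smul, h.one_mul, h.imUnit_mul_mul hI,
    smul_neg]
  abel

theorem phi_mul_phi (h : IsSliceAlgebra re) {I : A} (hI : I ∈ imUnits A) (z w : ℂ) :
    phi I z * phi I w = phi I (z * w) := by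
  have h1 : phi I w = w.re • (1 : A) + I * (w.im • (1 : A)) := by
    rw [h.mul_smul, h.mul_one, phi]
  rw [h1, h.phi_mul_induced hI]
  simp only [phi, h.mul_smul, h.mul_one, smul_smul, ← add_smul, ← sub_smul,
    Complex.mul_re, Complex.mul_im]
  rw [add_comm (z.re * w.im)]

theorem npowRec_phi (h : IsSliceAlgebra re) {I : A} (hI : I ∈ imUnits A) (z : ℂ) (k : ℕ) :
    npowRec k (phi I z) = phi I (z ^ k) := by
  induction k with
  | zero => simp [npowRec, phi]
  | succ k ih => rw [npowRec, ih, h.phi_mul_phi hI, pow_succ]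

theorem star_phi (h : IsSliceAlgebra re) {I : A} (hI : I ∈ imUnits A) (z : ℂ) :
    star (phi I z) = phi I (conj z) := by
  rw [h.star_eq, h.re_phi hI]
  simp only [phi, Complex.conj_re, Complex.conj_im, two_mul, add_smul, neg_smul]
  abel

omit [Mul A] [Star A] in
theorem phi_sub (I : A) (z w : ℂ) : phi I (z - w) = phi I z - phi I w := by
  simp only [phi, Complex.sub_re, Complex.sub_im, sub_smul]; abel

omit [Mul A] [Star A] in
theorem phi_add (I : A) (z w : ℂ) : phi I (z + w) = phi I z + phi I w := by
  simp only [phi, Complex.add_re, Complex.add_im, add_smul]; abel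

theorem mem_circularised_iff (h : IsSliceAlgebra re) (hne : (imUnits A).Nonempty) {D : Set ℂ}
    (hD : ∀ z ∈ D, conj z ∈ D) {x : A} : x ∈ circularised D ↔ profile re x ∈ D := by
  constructor
  · rintro ⟨I, hI, z, hz, rfl⟩
    rwa [h.profile_phi hI, upperRep_mem_iff hD]
  · intro hx
    obtain ⟨J, hJ, hxJ⟩ := h.exists_eq_phi_profile hne x
    exact ⟨J, hJ, _, hx, hxJ⟩

theorem phi_mem_circularised_iff (h : IsSliceAlgebra re) {D : Set ℂ}
    (hD : ∀ z ∈ D, conj z ∈ D) {I : A} (hI : I ∈ imUnits A) {z : ℂ} :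
    phi I z ∈ circularised D ↔ z ∈ D := by
  rw [h.mem_circularised_iff ⟨I, hI⟩ hD, h.profile_phi hI, upperRep_mem_iff hD]

/-- The spheres are the fibres of `profile re`, which turns saturated subsets of `A` into subsets of
the closed upper half-plane. -/
theorem mem_sph_iff (h : IsSliceAlgebra re) (hne : (imUnits A).Nonempty) {x y : A} :
    x ∈ sph y ↔ profile re x = profile re y := by
  constructor
  · rintro ⟨z, ⟨I, hI, rfl⟩, J, hJ, rfl⟩
    rw [h.profile_phi hI, h.profile_phi hJ]
  · intro hxy
    obtain ⟨J, hJ, hx⟩ := h.exists_eq_phi_profile hne x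
    refine ⟨profile re y, h.exists_eq_phi_profile hne y, J, hJ, ?_⟩
    rwa [← hxy]

theorem isRealPoint_iff (h : IsSliceAlgebra re) {x : A} :
    IsRealPoint x ↔ (profile re x).im = 0 := by
  simp only [profile, norm_eq_zero, sub_eq_zero]
  constructor
  · rintro ⟨r, rfl⟩
    simp [h.re_one]
  · exact fun hx => ⟨_, hx⟩

theorem sph_eq_singleton (h : IsSliceAlgebra re) (hne : (imUnits A).Nonempty) {y : A}
    (hy : IsRealPoint y) : sph y = {y} := by
  ext x
  rw [h.mem_sph_iff hne, Set.mem_singleton_iff]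
  refine ⟨fun hxy => ?_, fun hxy => by rw [hxy]⟩
  rw [h.isRealPoint_iff] at hy
  obtain ⟨J, -, hx⟩ := h.exists_eq_phi_profile hne x
  obtain ⟨K, -, hy'⟩ := h.exists_eq_phi_profile hne y
  rw [hx, hy', hxy, phi, phi, hy, zero_smul, zero_smul]

/-- The function of a complex variable that induces `singFactor y`, where `w` is the profile
of `y`. -/
def singStem (w z : ℂ) : ℂ := if w.im = 0 then z - w else z * z - z * (w + conj w) + w * conj w

theorem singFactor_phi (h : IsSliceAlgebra re) (hne : (imUnits A).Nonempty) (y : A) {I : A}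
    (hI : I ∈ imUnits A) (z : ℂ) :
    singFactor y (phi I z) = phi I (singStem (profile re y) z) := by
  obtain ⟨J, hJ, hy⟩ := h.exists_eq_phi_profile hne y
  set w := profile re y with hw
  rw [singFactor, singStem, h.isRealPoint_iff, ← hw]
  split_ifs with h0
  · rw [phi_sub, hy]
    congr 1
    simp [phi, h0]
  · have h1 : y + star y = phi I (w + conj w) := by
      rw [hy, h.star_phi hJ, ← phi_add, Complex.add_conj, phi_ofReal, phi_ofReal]
    have h2 : y * star y = phi I (w * conj w) := by
      rw [hy, h.star_phi hJ, h.phi_mul_phi hJ, Complex.mul_conj, phi_ofReal, phi_ofReal]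
    rw [h1, h2, h.phi_mul_phi hI, h.phi_mul_phi hI, ← phi_sub, ← phi_add]

theorem singStem_conj (w z : ℂ) : singStem w (conj z) = conj (singStem w z) := by
  unfold singStem
  split_ifs with h0
  · simp [Complex.conj_eq_iff_im.2 h0]
  · simp only [map_add, map_sub, map_mul, Complex.conj_conj]; ring

/-- `singStem w` is `z - w` for real `w` and `(z - w) * (z - conj w)` otherwise, so it contains the
factor `z - z₀` for both `z₀ = w` and `z₀ = conj w`. -/
theorem exists_singStem_eq (w : ℂ) (z₀ : ℂ) (hz₀ : upperRep z₀ = w) :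
    ∃ q : ℂ → ℂ, Continuous q ∧ ∀ z, singStem w z = q z * (z - z₀) := by
  subst hz₀
  by_cases h0 : (upperRep z₀).im = 0
  · refine ⟨1, continuous_const, fun z => ?_⟩
    have : upperRep z₀ = z₀ := by
      apply upperRep_of_nonneg; simp [upperRep] at h0; simp [h0]
    rw [singStem, if_pos h0, this]; simp
  · refine ⟨fun z => z - conj z₀, by fun_prop, fun z => ?_⟩
    rw [singStem, if_neg h0]
    rcases upperRep_eq_or z₀ with h | h <;> rw [h]
    · ring
    · rw [Complex.conj_conj]; ring

theorem differentiable_singStem (w : ℂ) : Differentiable ℂ (singStem w) := by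
  unfold singStem
  split_ifs <;> fun_prop

theorem exists_induces (h : IsSliceAlgebra re) {D : Set ℂ} {F : ℂ → A × A} (hF : IsStem D F) :
    ∃ f : A → A, Induces D F f := by
  refine ⟨fun x => (F (profile re x)).1 +
    (‖x - re x • (1 : A)‖⁻¹ • (x - re x • (1 : A))) * (F (profile re x)).2, fun I hI z hz => ?_⟩
  have hFz := hF z hz
  simp only [h.profile_phi hI, h.phi_sub_re hI, norm_smul, h.norm_imUnit hI, _root_.mul_one,
    Real.norm_eq_abs, smul_smul]
  -- Below the real axis the signs of the imaginary unit and of `F₂` cancel. On the axis the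
  -- normalised imaginary part is the default value `0`, which is harmless because a stem function
  -- has `F₂ = 0` there.
  rcases lt_trichotomy z.im 0 with h0 | h0 | h0
  · have : upperRep z = conj z := by apply Complex.ext <;> simp [upperRep, abs_of_neg h0]
    rw [this, hFz.1, hFz.2, abs_of_neg h0]
    rw [inv_neg, _root_.neg_mul, inv_mul_cancel₀ h0.ne, neg_one_smul, h.neg_mul, h.mul_neg, neg_neg]
  · have hc : conj z = z := Complex.conj_eq_iff_im.2 h0
    have h2 : (F z).2 = 0 := by
      have := hFz.2
      rw [hc] at this
      have h3 : (2 : ℝ) • (F z).2 = 0 := by rw [two_smul]; nth_rw 1 [this]; simp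
      exact (smul_eq_zero.1 h3).resolve_left two_ne_zero
    rw [upperRep_of_nonneg h0.ge, h2, h.mul_zero, h.mul_zero]
  · rw [upperRep_of_nonneg h0.le, abs_of_pos h0, inv_mul_cancel₀ h0.ne', one_smul]

end IsSliceAlgebra
end SliceNash
end

/-! ### Algebraic functions of one complex variable near isolated singularities. -/

noncomputable section
namespace SliceNash

open Polynomial Filter Asymptotics
open scoped ComplexConjugate Topology Polynomial.Bivariate

theorem evalEval_eq_sum (P : ℂ[X][Y]) (w t : ℂ) :
    P.evalEval w t = ∑ i ∈ Finset.range (P.natDegree + 1), (P.coeff i).eval w * t ^ i := by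
  rw [← map_evalRingHom_eval, eval_map, eval₂_eq_sum_range]
  rfl

theorem differentiableOn_evalEval (P : ℂ[X][Y]) {c : ℂ → ℂ} {D : Set ℂ}
    (hc : DifferentiableOn ℂ c D) : DifferentiableOn ℂ (fun w => P.evalEval w (c w)) D := by
  simp only [evalEval_eq_sum]
  exact DifferentiableOn.fun_sum fun i _ =>
    (P.coeff i).differentiable.differentiableOn.mul (hc.pow i)

/-- A root of a polynomial with coefficients depending polynomially on `w`, multiplied by the
leading coefficient, is locally bounded. -/
theorem isBigO_leadingCoeff_mul {P : ℂ[X][Y]} {c : ℂ → ℂ} {z : ℂ} {l : Filter ℂ} (hl : l ≤ 𝓝 z)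
    (h : ∀ᶠ w in l, P.evalEval w (c w) = 0) :
    (fun w => P.leadingCoeff.eval w * c w) =O[l] fun _ => (1 : ℝ) := by
  have hcont : Continuous fun w => ∑ i ∈ Finset.range P.natDegree, ‖(P.coeff i).eval w‖ +
      ‖P.leadingCoeff.eval w‖ := by fun_prop
  refine IsBigO.trans (IsBigO.of_bound 1 ?_) (((hcont.tendsto z).mono_left hl).isBigO_one ℝ)
  filter_upwards [h] with w hw
  rw [one_mul, norm_mul]
  refine le_trans ?_ (le_abs_self _)
  have hS : 0 ≤ ∑ i ∈ Finset.range P.natDegree, ‖(P.coeff i).eval w‖ := by positivity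
  by_cases h0 : P.leadingCoeff.eval w = 0
  · simp only [h0, norm_zero, zero_mul, add_zero]; exact hS
  set p := P.map (evalRingHom w) with hp
  have hlead : evalRingHom w P.leadingCoeff ≠ 0 := h0
  have hdeg : p.natDegree = P.natDegree := natDegree_map_of_leadingCoeff_ne_zero _ hlead
  have hlc : p.leadingCoeff = P.leadingCoeff.eval w := leadingCoeff_map_of_leadingCoeff_ne_zero _ hlead
  have hp0 : p ≠ 0 := fun h => h0 (by rw [← hlc, h, leadingCoeff_zero])
  have hroot : p.IsRoot (c w) := by rw [IsRoot, hp, map_evalRingHom_eval, hw]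
  -- Cauchy's bound is the largest norm of a lower coefficient divided by the norm of the leading
  -- one, plus 1. Multiplying by the latter norm clears the denominator and leaves a continuous
  -- function of `w`.
  have hb : ‖c w‖ ≤ p.cauchyBound := NNReal.coe_le_coe.2 (hroot.norm_lt_cauchyBound hp0).le
  have hpos : 0 < ‖P.leadingCoeff.eval w‖ := norm_pos_iff.2 h0
  have hsup : ((Finset.range p.natDegree).sup fun i => ‖p.coeff i‖₊ : NNReal) ≤
      ∑ i ∈ Finset.range P.natDegree, ‖(P.coeff i).eval w‖₊ := by
    refine Finset.sup_le fun i hi => ?_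
    rw [hdeg] at hi
    have := Finset.single_le_sum (f := fun i => ‖(P.coeff i).eval w‖₊) (fun _ _ => zero_le) hi
    simpa [hp] using this
  have hsup' : (((Finset.range p.natDegree).sup fun i => ‖p.coeff i‖₊ : NNReal) : ℝ) ≤
      ∑ i ∈ Finset.range P.natDegree, ‖(P.coeff i).eval w‖ := by
    simpa using NNReal.coe_le_coe.2 hsup
  rw [cauchyBound, hlc] at hb
  push_cast at hb
  calc ‖P.leadingCoeff.eval w‖ * ‖c w‖ ≤ ‖P.leadingCoeff.eval w‖ * _ :=
        mul_le_mul_of_nonneg_left hb hpos.le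
    _ = (((Finset.range p.natDegree).sup fun i => ‖p.coeff i‖₊ : NNReal) : ℝ) +
        ‖P.leadingCoeff.eval w‖ := by
      field_simp
    _ ≤ _ := by gcongr

/-- The leading coefficient is `(w - z) ^ m * q(w)` with `q(z) ≠ 0`, and the factor `q` can be
divided out near `z`. -/
theorem exists_isBigO_sub_pow_mul {P : ℂ[X][Y]} (hP : P ≠ 0) {c : ℂ → ℂ} {z : ℂ} {l : Filter ℂ}
    (hl : l ≤ 𝓝 z) (h : ∀ᶠ w in l, P.evalEval w (c w) = 0) :
    ∃ m : ℕ, (fun w => (w - z) ^ m * c w) =O[l] fun _ => (1 : ℝ) := by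
  obtain ⟨q, hq, hdvd⟩ := exists_eq_pow_rootMultiplicity_mul_and_not_dvd P.leadingCoeff
    (leadingCoeff_ne_zero.2 hP) z
  rw [dvd_iff_isRoot, IsRoot] at hdvd
  refine ⟨P.leadingCoeff.rootMultiplicity z, ?_⟩
  have h1 : (fun w => (q.eval w)⁻¹) =O[l] fun _ => (1 : ℝ) :=
    ((q.continuous.tendsto z).inv₀ hdvd |>.mono_left hl).isBigO_one ℝ
  have h2 := h1.mul (isBigO_leadingCoeff_mul hl h)
  simp only [mul_one] at h2
  refine h2.congr' ?_ EventuallyEq.rfl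
  filter_upwards [(q.continuous.continuousAt.eventually_ne hdvd).filter_mono hl] with w hw
  rw [hq]
  simp only [eval_mul, eval_pow, eval_sub, eval_X, eval_C]
  field_simp
  rw [← hq, mul_comm]

/-- For positive radius, `w ↦ z + exp w` maps a left half-plane onto the punctured disc. -/
theorem isPreconnected_punctured_ball (z : ℂ) (r : ℝ) :
    IsPreconnected (Metric.ball z r \ {z}) := by
  rcases le_or_gt r 0 with hr | hr
  · rw [Metric.ball_eq_empty.2 hr, Set.empty_sdiff]; exact isPreconnected_empty
  have : Metric.ball z r \ {z} = (fun w => z + Complex.exp w) '' {w | w.re < Real.log r} := by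
    ext w
    simp only [Set.mem_sdiff, Metric.mem_ball, dist_eq_norm, Set.mem_singleton_iff, Set.mem_image,
      Set.mem_ofPred_eq]
    constructor
    · rintro ⟨h1, h2⟩
      have h3 : w - z ≠ 0 := sub_ne_zero.2 h2
      refine ⟨Complex.log (w - z), ?_, ?_⟩
      · rw [Complex.log_re]
        exact Real.log_lt_log (norm_pos_iff.2 h3) h1
      · rw [Complex.exp_log h3]; ring
    · rintro ⟨v, hv, rfl⟩
      rw [add_sub_cancel_left, Complex.norm_exp]
      exact ⟨by rwa [← Real.lt_log_iff_exp_lt hr], by simp⟩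
  rw [this]
  exact (convex_halfSpace_re_lt _).isPreconnected.image _ (by fun_prop)

/-- Propagation of an algebraic relation along a preconnected set, across isolated
singularities. -/
theorem eventually_evalEval_eq_zero {D K : Set ℂ} {c : ℂ → ℂ} (hD : IsOpen D)
    (hc : DifferentiableOn ℂ c D) (hKD : ∀ z ∈ K, D ∈ 𝓝[≠] z) (hK : IsPreconnected K)
    {P : ℂ[X][Y]} {z₁ : ℂ} (hz₁ : z₁ ∈ K) (h₁ : ∀ᶠ w in 𝓝[≠] z₁, P.evalEval w (c w) = 0)
    {z : ℂ} (hz : z ∈ K) : ∀ᶠ w in 𝓝[≠] z, P.evalEval w (c w) = 0 := by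
  -- Connectedness argument: `u` is open, and it contains each point of `K` in its closure, by the
  -- identity theorem on a punctured disc.
  set u : Set ℂ := {z | ∀ᶠ w in 𝓝[≠] z, P.evalEval w (c w) = 0} with hu
  have hopen : IsOpen u := by
    rw [isOpen_iff_mem_nhds]
    intro z hz
    have hz' := eventually_nhdsWithin_iff.1 hz
    filter_upwards [hz'.eventually_nhds] with y hy
    by_cases hyz : y = z
    · rwa [hyz]
    · refine (hy.and (eventually_ne_nhds hyz)).filter_mono nhdsWithin_le_nhds |>.mono ?_
      exact fun w hw => hw.1 hw.2
  refine hK.subset_of_closure_inter_subset hopen ⟨z₁, hz₁, h₁⟩ ?_ hz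
  rintro y ⟨hyu, hyK⟩
  obtain ⟨r, hr, hrD⟩ := Metric.mem_nhdsWithin_iff.1 (hKD y hyK)
  rw [← Set.sdiff_eq] at hrD
  obtain ⟨x, hxu, hxy⟩ := Metric.mem_closure_iff.1 hyu r hr
  have hxb : x ∈ Metric.ball y r := by rwa [Metric.mem_ball, dist_comm]
  have hball : ∀ᶠ w in 𝓝[≠] x, w ∈ Metric.ball y r ∧ w ≠ y := by
    refine Eventually.and (nhdsWithin_le_nhds (Metric.isOpen_ball.mem_nhds hxb)) ?_
    by_cases hxy' : x = y
    · subst hxy'; exact eventually_mem_nhdsWithin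
    · exact (eventually_ne_nhds hxy').filter_mono nhdsWithin_le_nhds
  -- The relation may fail at `x` itself, which may also be the centre `y`. The identity theorem is
  -- therefore started at a nearby `v` where the relation holds on a full neighbourhood.
  have hev : ∀ᶠ v in 𝓝[≠] x, ∀ᶠ w in 𝓝 v, P.evalEval w (c w) = 0 := by
    have hz' := (eventually_nhdsWithin_iff.1 hxu).eventually_nhds
    refine eventually_nhdsWithin_iff.2 (hz'.mono fun v hv hvx => ?_)
    exact (hv.and (eventually_ne_nhds hvx)).mono fun w hw => hw.1 hw.2
  obtain ⟨v, hv, hvb⟩ := (hev.and hball).exists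
  have han : AnalyticOnNhd ℂ (fun w => P.evalEval w (c w)) (Metric.ball y r \ {y}) :=
    ((differentiableOn_evalEval P hc).analyticOnNhd hD).mono hrD
  have heq := han.eqOn_zero_of_preconnected_of_eventuallyEq_zero
    (isPreconnected_punctured_ball y r) ⟨hvb.1, hvb.2⟩ hv
  rw [hu, Set.mem_ofPred_eq, eventually_nhdsWithin_iff]
  filter_upwards [Metric.ball_mem_nhds y hr] with w hw hwy
  exact heq ⟨hw, hwy⟩

/-- Riemann's theorem for all the isolated singularities at once. -/
theorem exists_holomorphic_extension {D E : Set ℂ} {c : ℂ → ℂ} (hD : IsOpen D)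
    (hc : DifferentiableOn ℂ c D) (hED : ∀ z ∈ E, D ∈ 𝓝[≠] z)
    (hb : ∀ z ∈ E, c =O[𝓝[≠] z] fun _ => (1 : ℝ)) :
    ∃ g : ℂ → ℂ, DifferentiableOn ℂ g E ∧ (∀ z ∈ D, g z = c z) ∧
      ∀ z ∈ E, Tendsto c (𝓝[≠] z) (𝓝 (g z)) := by
  have hgD : ∀ z ∈ D, limUnder (𝓝[≠] z) c = c z := fun z hz =>
    ((hc.differentiableAt (hD.mem_nhds hz)).continuousAt.tendsto.mono_left
      nhdsWithin_le_nhds).limUnder_eq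
  have ho : ∀ z ∈ E, (fun w => c w - c z) =o[𝓝[≠] z] fun w => (w - z)⁻¹ := fun z hz => by
    apply IsBoundedUnder.isLittleO_sub_self_inv
    have h1 : (fun w => c w - c z) =O[𝓝[≠] z] fun _ => (1 : ℝ) :=
      (hb z hz).sub (isBigO_const_const _ one_ne_zero _)
    exact isBigO_one_iff ℝ |>.1 h1
  have hup : ∀ z ∈ E, DifferentiableOn ℂ (Function.update c z (limUnder (𝓝[≠] z) c))
      (insert z D) := fun z hz =>
    Complex.differentiableOn_update_limUnder_insert_of_isLittleO (hED z hz) hc (ho z hz)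
  -- The punctured limit defines all the extensions by one formula. It equals `c` on `D`, hence
  -- agrees near each `z ∈ E` with the local Riemann extension at `z`.
  refine ⟨fun z => limUnder (𝓝[≠] z) c, fun z hz => ?_, hgD, fun z hz => ?_⟩
  · have hins : insert z D ∈ 𝓝 z := insert_mem_nhds_iff.2 (hED z hz)
    refine (((hup z hz).differentiableAt hins).congr_of_eventuallyEq ?_).differentiableWithinAt
    filter_upwards [hins] with w hw
    rcases eq_or_ne w z with rfl | hwz
    · simp
    · rw [Function.update_of_ne hwz, hgD w (hw.resolve_left hwz)]
  · have hins : insert z D ∈ 𝓝 z := insert_mem_nhds_iff.2 (hED z hz)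
    exact continuousAt_update_same.1 ((hup z hz).differentiableAt hins).continuousAt

end SliceNash
end

/-! ### Stem functions from complex components, and their extension across singularities. -/

noncomputable section
namespace SliceNash

open Filter Asymptotics
open scoped ComplexConjugate Topology

variable {A : Type*} [NormedAddCommGroup A] [NormedSpace ℝ A] {ι : Type*} [Fintype ι]
  (b : Module.Basis ι ℝ A)

/-- The function with values in `A ⊗ ℂ` whose components along the real base `b` are `c`. -/
def ofComponents (c : ι → ℂ → ℂ) (z : ℂ) : A × A :=
  (∑ j, (c j z).re • b j, ∑ j, (c j z).im • b j)

theorem component_ofComponents (c : ι → ℂ → ℂ) (j : ι) :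
    component b (ofComponents b c) j = c j := by
  funext z
  exact Complex.ext (congrFun (b.repr_sum_self _) j) (congrFun (b.repr_sum_self _) j)

theorem ofComponents_component_mul (p : ℂ → ℂ) (F : ℂ → A × A) (z : ℂ) :
    ofComponents b (fun j w => p w * component b F j w) z =
      ((p z).re • (F z).1 - (p z).im • (F z).2, (p z).im • (F z).1 + (p z).re • (F z).2) := by
  have h1 := b.sum_repr (F z).1
  have h2 := b.sum_repr (F z).2
  simp only [ofComponents, component, Complex.mul_re, Complex.mul_im, sub_smul, add_smul,
    Finset.sum_sub_distrib, Finset.sum_add_distrib, mul_smul, ← Finset.smul_sum, h1, h2]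
  rw [add_comm ((p z).re • (F z).2)]

omit [Fintype ι] in
theorem component_conj {D : Set ℂ} {F : ℂ → A × A} (hF : IsStem D F) (j : ι) {z : ℂ}
    (hz : z ∈ D) : component b F j (conj z) = conj (component b F j z) := by
  apply Complex.ext <;> simp [component, (hF z hz).1, (hF z hz).2]

theorem isStem_ofComponents {E : Set ℂ} {c : ι → ℂ → ℂ}
    (hc : ∀ j, ∀ z ∈ E, c j (conj z) = conj (c j z)) : IsStem E (ofComponents b c) := by
  intro z hz
  constructor <;> simp [ofComponents, fun j => hc j z hz]

theorem isHolomorphicStem_ofComponents {E : Set ℂ} (hE : IsOpen E) {c : ι → ℂ → ℂ}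
    (hc : ∀ j, DifferentiableOn ℂ (c j) E) : IsHolomorphicStem E (ofComponents b c) := by
  constructor
  · have h1 (j : ι) : ContDiffOn ℝ 1 (c j) E :=
      ((hc j).contDiffOn hE).restrict_scalars ℝ
    have h2 (j : ι) : ContDiffOn ℝ 1 (fun z => (c j z).re) E :=
      Complex.reCLM.contDiff.comp_contDiffOn (h1 j)
    have h3 (j : ι) : ContDiffOn ℝ 1 (fun z => (c j z).im) E :=
      Complex.imCLM.contDiff.comp_contDiffOn (h1 j)
    exact (ContDiffOn.sum fun j _ => (h2 j).smul contDiffOn_const).prodMk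
      (ContDiffOn.sum fun j _ => (h3 j).smul contDiffOn_const)
  · intro z hz
    have hd (j : ι) : HasFDerivAt (c j)
        ((ContinuousLinearMap.toSpanSingleton ℂ (deriv (c j) z)).restrictScalars ℝ) z :=
      (((hc j).differentiableAt (hE.mem_nhds hz)).hasDerivAt.hasFDerivAt).restrictScalars ℝ
    have h1 : HasFDerivAt (fun w => (ofComponents b c w).1) _ z :=
      HasFDerivAt.fun_sum (u := Finset.univ) fun j _ =>
        (Complex.reCLM.hasFDerivAt.comp z (hd j)).smul_const (b j)
    have h2 : HasFDerivAt (fun w => (ofComponents b c w).2) _ z :=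
      HasFDerivAt.fun_sum (u := Finset.univ) fun j _ =>
        (Complex.imCLM.hasFDerivAt.comp z (hd j)).smul_const (b j)
    rw [h1.fderiv, h2.fderiv]
    constructor <;> simp

variable [Mul A] [One A] [Star A] {re : A →ₗ[ℝ] ℝ}

theorem tendsto_conj_punctured (z : ℂ) : Tendsto conj (𝓝[≠] (conj z)) (𝓝[≠] z) := by
  refine tendsto_nhdsWithin_of_tendsto_nhds_of_eventually_within _ ?_ ?_
  · have := (Complex.continuous_conj.tendsto (conj z)).mono_left
      (nhdsWithin_le_nhds (s := {conj z}ᶜ))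
    rwa [Complex.conj_conj] at this
  · filter_upwards [self_mem_nhdsWithin] with w hw h
    rw [Set.mem_singleton_iff] at h
    exact hw (by rw [Set.mem_singleton_iff, ← h, Complex.conj_conj])

/-- If the components of `p F` are locally bounded on `E`, then `p f` extends to a slice regular
function on `Ω_E`. -/
theorem IsSliceAlgebra.exists_extension (h : IsSliceAlgebra re) {D E : Set ℂ} {F : ℂ → A × A}
    {f : A → A} (hD : IsStemDomain D) (hF : IsStem D F) (hf : Induces D F f)
    (hc : ∀ j, DifferentiableOn ℂ (component b F j) D) (hE : IsStemDomain E)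
    (hED : ∀ z ∈ E, D ∈ 𝓝[≠] z) {p : ℂ → ℂ} (hp : Differentiable ℂ p)
    (hpc : ∀ z, p (conj z) = conj (p z))
    (hb : ∀ z ∈ E, ∀ j, (fun w => p w * component b F j w) =O[𝓝[≠] z] fun _ => (1 : ℝ))
    (hDE : D ⊆ E) :
    ∃ (G : ℂ → A × A) (Φ : A → A), IsStem E G ∧ Induces E G Φ ∧ IsHolomorphicStem E G ∧
      (∀ j, DifferentiableOn ℂ (component b G j) E) ∧
      (∀ j, ∀ z ∈ E,
        Tendsto (fun w => p w * component b F j w) (𝓝[≠] z) (𝓝 (component b G j z))) ∧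
      ∀ I ∈ imUnits A, ∀ z ∈ D, Φ (phi I z) = phi I (p z) * f (phi I z) := by
  choose g hg hgD hgE using fun j => exists_holomorphic_extension hD.2.1
    (hp.differentiableOn.mul (hc j)) hED fun z hz => hb z hz j
  -- The stem symmetry holds on `D` and survives in the limit at the points filled in.
  have hconj : ∀ j, ∀ z ∈ E, g j (conj z) = conj (g j z) := by
    intro j z hz
    refine tendsto_nhds_unique (hgE j _ (hE.2.2 z hz)) ?_
    have h1 := (Complex.continuous_conj.tendsto _).comp
      ((hgE j z hz).comp (tendsto_conj_punctured z))
    refine h1.congr' ?_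
    filter_upwards [hED _ (hE.2.2 z hz)] with w hw
    simp only [Function.comp_apply, Pi.mul_apply]
    rw [component_conj b hF j hw, hpc, map_mul, Complex.conj_conj, Complex.conj_conj]
  have hstem := isStem_ofComponents b hconj
  obtain ⟨Φ, hΦ⟩ := h.exists_induces hstem
  refine ⟨ofComponents b g, Φ, hstem, hΦ, isHolomorphicStem_ofComponents b hE.2.1 hg,
    fun j => by rw [component_ofComponents]; exact hg j,
    fun j z hz => by rw [component_ofComponents]; exact hgE j z hz, fun I hI z hz => ?_⟩
  have h2 : ofComponents b g z = ofComponents b (fun j w => p w * component b F j w) z := by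
    have h3 : ∀ j, g j z = p z * component b F j z := fun j => hgD j z hz
    simp only [ofComponents, h3]
  rw [hΦ I hI z (hDE hz), hf I hI z hz, h2, ofComponents_component_mul, h.phi_mul_induced hI]

/-- A slice regular function is bounded near each sphere `𝕊_y`. -/
theorem IsSliceAlgebra.exists_bound_near_sph (h : IsSliceAlgebra re) (hne : (imUnits A).Nonempty)
    {U : Set A} {Φ : A → A} (hΦ : IsSliceRegularOn U Φ) {y : A} (hy : y ∈ U) :
    ∃ V : Set A, IsOpen V ∧ sph y ⊆ V ∧ V ⊆ U ∧ ∃ M : ℝ, ∀ x ∈ V, ‖Φ x‖ ≤ M := by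
  obtain ⟨D, G, hD, rfl, -, hind, hhol⟩ := hΦ
  rw [h.mem_circularised_iff hne hD.2.2] at hy
  have hcont : ContinuousAt G (profile re y) :=
    hhol.1.continuousOn.continuousAt (hD.2.1.mem_nhds hy)
  have hev : ∀ᶠ z in 𝓝 (profile re y), z ∈ D ∧ ‖G z‖ < ‖G (profile re y)‖ + 1 :=
    Eventually.and (hD.2.1.mem_nhds hy)
      (hcont.norm.eventually_lt continuousAt_const (lt_add_one _))
  obtain ⟨W, hW, hWo, hyW⟩ := eventually_nhds_iff.1 hev
  -- The factor 5 is 1 for `F₁` plus 4 from `norm_mul_le` applied to `J * F₂` with `‖J‖ = 1`.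
  refine ⟨profile re ⁻¹' W, hWo.preimage h.continuous_profile, fun x hx => ?_, fun x hx => ?_,
    5 * (‖G (profile re y)‖ + 1), fun x hx => ?_⟩
  · rw [h.mem_sph_iff hne] at hx
    rwa [Set.mem_preimage, hx]
  · exact (h.mem_circularised_iff hne hD.2.2).2 (hW _ hx).1
  · obtain ⟨J, hJ, hxJ⟩ := h.exists_eq_phi_profile hne x
    obtain ⟨h1, h2⟩ := hW _ hx
    rw [hxJ, hind J hJ _ h1]
    have h3 := h.norm_mul_le J (G (profile re x)).2
    rw [h.norm_imUnit hJ] at h3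
    have h4 := norm_add_le (G (profile re x)).1 (J * (G (profile re x)).2)
    have h5 := norm_fst_le (G (profile re x))
    have h6 := norm_snd_le (G (profile re x))
    linarith

end SliceNash
end

/-! ### Slice-Nash functions with isolated singularities: the local statements. -/

noncomputable section
namespace SliceNash

open Filter Asymptotics Polynomial
open scoped ComplexConjugate Topology Polynomial.Bivariate

theorem IsComplexNashOn.differentiableOn {D : Set ℂ} {g : ℂ → ℂ} (hg : IsComplexNashOn D g) :
    DifferentiableOn ℂ g D := by
  intro z hz
  obtain ⟨U, -, hzU, -, han, -⟩ := hg z hz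
  exact (han z hzU).differentiableAt.differentiableWithinAt

/-- A Nash function satisfies an algebraic equation along each preconnected set of points at which
its singularities are isolated. -/
theorem IsComplexNashOn.exists_evalEval_eq_zero {D K : Set ℂ} {g : ℂ → ℂ} (hD : IsOpen D)
    (hg : IsComplexNashOn D g) (hKD : ∀ z ∈ K, D ∈ 𝓝[≠] z) (hK : IsPreconnected K)
    (hKne : (K ∩ D).Nonempty) :
    ∃ P : ℂ[X][Y], P ≠ 0 ∧ ∀ z ∈ K, ∀ᶠ w in 𝓝[≠] z, P.evalEval w (g w) = 0 := by
  obtain ⟨z₁, hz₁K, hz₁D⟩ := hKne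
  obtain ⟨U, hU, hzU, -, -, P, hP, hPU⟩ := hg z₁ hz₁D
  exact ⟨P, hP, fun z hz => eventually_evalEval_eq_zero hD hg.differentiableOn hKD hK hz₁K
    (Eventually.filter_mono nhdsWithin_le_nhds
      (Filter.mem_of_superset (hU.mem_nhds hzU) hPU)) hz⟩

/-- At each isolated singularity of a Nash function the function has at most a pole. -/
theorem IsComplexNashOn.exists_isBigO_sub_pow_mul {D E : Set ℂ} {g : ℂ → ℂ} (hD : IsOpen D)
    (hg : IsComplexNashOn D g) (hE : IsOpen E) (hED : ∀ z ∈ E, D ∈ 𝓝[≠] z) {z : ℂ} (hz : z ∈ E) :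
    ∃ m : ℕ, (fun w => (w - z) ^ m * g w) =O[𝓝[≠] z] fun _ => (1 : ℝ) := by
  obtain ⟨r, hr, hrE⟩ := Metric.isOpen_iff.1 hE z hz
  have hne : (Metric.ball z r ∩ D).Nonempty := by
    have h1 : Metric.ball z r ∩ D ∈ 𝓝[≠] z :=
      inter_mem (nhdsWithin_le_nhds (Metric.ball_mem_nhds z hr)) (hED z hz)
    exact nonempty_of_mem h1
  obtain ⟨P, hP, hPz⟩ := hg.exists_evalEval_eq_zero hD (fun w hw => hED w (hrE hw))
    (convex_ball z r).isPreconnected hne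
  exact SliceNash.exists_isBigO_sub_pow_mul hP nhdsWithin_le_nhds
    (hPz z (Metric.mem_ball_self hr))

/-- By continuity the algebraic relation persists at a point filled in by a limit, so the extension
is again Nash there. -/
theorem evalEval_eq_zero_of_tendsto {P : ℂ[X][Y]} {c : ℂ → ℂ} {z t : ℂ}
    (h : ∀ᶠ w in 𝓝[≠] z, P.evalEval w (c w) = 0) (ht : Tendsto c (𝓝[≠] z) (𝓝 t)) :
    P.evalEval z t = 0 := by
  have h1 : Tendsto (fun w => P.evalEval w (c w)) (𝓝[≠] z) (𝓝 (P.evalEval z t)) := by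
    simp only [evalEval_eq_sum]
    exact tendsto_finsetSum _ fun i _ =>
      (((P.coeff i).continuous.tendsto z).mono_left nhdsWithin_le_nhds).mul (ht.pow i)
  exact tendsto_nhds_unique h1 (tendsto_const_nhds.congr' (h.mono fun w hw => hw.symm))

variable {A : Type*} [NormedAddCommGroup A] [NormedSpace ℝ A] [Mul A] [One A] [Star A]
  {re : A →ₗ[ℝ] ℝ}

open IsSliceAlgebra

/-- `f = 𝓘(F)` is a slice-Nash function on `Ω \ Ω₀ = Ω_D`, where `Ω = Ω_E` and the points of
`E \ D` are isolated. -/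
structure IsSingularNash {u : ℕ} (re : A →ₗ[ℝ] ℝ) (Ω Ω₀ : Set A) (f : A → A) (D E : Set ℂ)
    (F : ℂ → A × A) (I : A) (b : Module.Basis (Fin (u + 1) × Fin 2) ℝ A) : Prop where
  slice : IsSliceAlgebra re
  discrete : IsDiscreteSingSet Ω Ω₀
  stemDomain : IsStemDomain D
  stemDomain' : IsStemDomain E
  eq_circ : Ω = circularised E
  sdiff_eq_circ : Ω \ Ω₀ = circularised D
  subset : D ⊆ E
  isolated : ∀ z ∈ E, D ∈ 𝓝[≠] z
  stem : IsStem D F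
  induces : Induces D F f
  mem_imUnits : I ∈ imUnits A
  splitting : IsSplittingBase I b
  nash : ∀ j, IsComplexNashOn D (component b F j)

/-- A circular set is induced by a symmetric set. -/
theorem IsSliceAlgebra.exists_symmetric (h : IsSliceAlgebra re)
    {U : Set A} (hU : IsCircular U) : ∃ E : Set ℂ, (∀ z ∈ E, conj z ∈ E) ∧ U = circularised E := by
  obtain ⟨D, rfl⟩ := hU
  have hE : ∀ z ∈ {z | z ∈ D ∨ conj z ∈ D}, conj z ∈ {z | z ∈ D ∨ conj z ∈ D} := by
    rintro z (hz | hz)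
    · exact Or.inr (by rwa [Complex.conj_conj])
    · exact Or.inl hz
  refine ⟨_, hE, Set.ext fun x => ?_⟩
  constructor
  · rintro ⟨I, hI, z, hz, rfl⟩
    exact ⟨I, hI, z, Or.inl hz, rfl⟩
  · rintro ⟨I, hI, z, hz | hz, rfl⟩
    · exact ⟨I, hI, z, hz, rfl⟩
    · refine ⟨-I, h.neg_mem_imUnits hI, conj z, hz, ?_⟩
      rw [← phi_conj, Complex.conj_conj]

/-- A slice `phi I` meets the sphere of `phi I z` only at `z` and `conj z`, so isolated spheres of
`Ω₀` give isolated points of `E \ D`. -/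
theorem exists_isSingularNash (h : IsSliceAlgebra re) {Ω Ω₀ : Set A} (hΩ_open : IsOpen Ω)
    (hΩ_circ : IsCircular Ω) (hΩ₀ : IsDiscreteSingSet Ω Ω₀) {f : A → A}
    (hf : IsSliceNashOn (Ω \ Ω₀) f) :
    ∃ (u : ℕ) (D E : Set ℂ) (F : ℂ → A × A) (I : A)
      (b : Module.Basis (Fin (u + 1) × Fin 2) ℝ A), IsSingularNash re Ω Ω₀ f D E F I b := by
  obtain ⟨D, F, hD, hDeq, hstem, hind, -, I, hI, u, b, hb, hnash⟩ := hf
  have hne : (imUnits A).Nonempty := ⟨I, hI⟩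
  obtain ⟨E, hEsym, rfl⟩ := h.exists_symmetric hΩ_circ
  have hDE : D ⊆ E := fun z hz => by
    have h1 : phi I z ∈ circularised E \ Ω₀ := hDeq ▸ ⟨I, hI, z, hz, rfl⟩
    exact (h.phi_mem_circularised_iff hEsym hI).1 h1.1
  have hE : IsStemDomain E := by
    refine ⟨hD.1.mono hDE, ?_, hEsym⟩
    have : E = phi I ⁻¹' circularised E := by
      ext z; exact (h.phi_mem_circularised_iff hEsym hI).symm
    rw [this]
    exact hΩ_open.preimage (continuous_phi I)
  refine ⟨u, D, E, F, I, b, h, hΩ₀, hD, hE, rfl, hDeq, hDE, fun z hz => ?_, hstem, hind, hI, hb,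
    hnash⟩
  by_cases hzD : z ∈ D
  · exact nhdsWithin_le_nhds (hD.2.1.mem_nhds hzD)
  have hmemD : ∀ w ∈ E, phi I w ∉ Ω₀ → w ∈ D := fun w hw hw0 => by
    refine (h.phi_mem_circularised_iff hD.2.2 hI).1 ?_
    rw [← hDeq]
    exact ⟨(h.phi_mem_circularised_iff hEsym hI).2 hw, hw0⟩
  have hz0 : phi I z ∈ Ω₀ := by
    by_contra h0; exact hzD (hmemD z hz h0)
  obtain ⟨hsub, V, hV, hVeq⟩ := hΩ₀.2.2 _ hz0
  have hzV : phi I z ∈ V := by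
    have : phi I z ∈ V ∩ Ω₀ := by rw [hVeq, h.mem_sph_iff hne]
    exact this.1
  have h1 : ∀ᶠ w in 𝓝[≠] z, phi I w ∈ V :=
    nhdsWithin_le_nhds ((hV.preimage (continuous_phi I)).mem_nhds hzV)
  have h2 : ∀ᶠ w in 𝓝[≠] z, w ∈ E := nhdsWithin_le_nhds (hE.2.1.mem_nhds hz)
  -- For real `z` the conjugate is the centre already removed; otherwise it is at a positive
  -- distance.
  have h3 : ∀ᶠ w in 𝓝[≠] z, w ≠ conj z := by
    by_cases hzz : z = conj z
    · rw [← hzz]; exact eventually_mem_nhdsWithin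
    · exact (eventually_ne_nhds hzz).filter_mono nhdsWithin_le_nhds
  filter_upwards [h1, h2, h3, eventually_mem_nhdsWithin] with w hw1 hw2 hw3 hw4
  refine hmemD w hw2 fun hw0 => ?_
  have h5 : phi I w ∈ sph (phi I z) := hVeq ▸ ⟨hw1, hw0⟩
  rw [h.mem_sph_iff hne, h.profile_phi hI, h.profile_phi hI] at h5
  rcases upperRep_eq_or w with hw | hw <;> rcases upperRep_eq_or z with hz' | hz' <;>
    rw [hw, hz'] at h5
  · exact hw4 h5
  · exact hw3 h5
  · exact hw3 (by rw [← h5, Complex.conj_conj])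
  · exact hw4 ((starRingEnd ℂ).injective h5)

namespace IsSingularNash

variable {u : ℕ} {Ω Ω₀ : Set A} {f : A → A} {D E : Set ℂ} {F : ℂ → A × A} {I : A}
  {b : Module.Basis (Fin (u + 1) × Fin 2) ℝ A}

theorem nonempty (H : IsSingularNash re Ω Ω₀ f D E F I b) : (imUnits A).Nonempty :=
  ⟨I, H.mem_imUnits⟩

theorem mem_iff (H : IsSingularNash re Ω Ω₀ f D E F I b) {x : A} :
    x ∈ Ω ↔ profile re x ∈ E := by
  rw [H.eq_circ, H.slice.mem_circularised_iff H.nonempty H.stemDomain'.2.2]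

theorem mem_sing_iff (H : IsSingularNash re Ω Ω₀ f D E F I b) {x : A} :
    x ∈ Ω₀ ↔ profile re x ∈ E \ D := by
  have h1 : x ∈ Ω \ Ω₀ ↔ profile re x ∈ D := by
    rw [H.sdiff_eq_circ, H.slice.mem_circularised_iff H.nonempty H.stemDomain.2.2]
  rw [Set.mem_sdiff, ← h1, ← H.mem_iff]
  exact ⟨fun hx => ⟨H.discrete.1 hx, fun h => h.2 hx⟩, fun hx => by
    by_contra h0; exact hx.2 ⟨hx.1, h0⟩⟩

theorem mem_aroundSing_sdiff (H : IsSingularNash re Ω Ω₀ f D E F I b) {x y : A}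
    (hx : x ∈ aroundSing Ω Ω₀ y \ sph y) : x ∈ circularised D := by
  rw [← H.sdiff_eq_circ]
  exact hx.1.resolve_right hx.2

theorem isBigO_of_mem (H : IsSingularNash re Ω Ω₀ f D E F I b) {z : ℂ} (hz : z ∈ D) (j) :
    component b F j =O[𝓝[≠] z] fun _ => (1 : ℝ) :=
  (((H.nash j).differentiableOn.differentiableAt
    (H.stemDomain.2.1.mem_nhds hz)).continuousAt.tendsto.mono_left
      nhdsWithin_le_nhds).isBigO_one ℝ

/-- If `p F` is bounded near the singularity `y`, then `p f` extends to a slice regular function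
near `𝕊_y`. -/
theorem exists_regular_extension (H : IsSingularNash re Ω Ω₀ f D E F I b) {y : A} (hy : y ∈ Ω₀)
    {p : ℂ → ℂ} (hp : Differentiable ℂ p) (hpc : ∀ z, p (conj z) = conj (p z))
    (hb : ∀ z, upperRep z = profile re y → ∀ j,
      (fun w => p w * component b F j w) =O[𝓝[≠] z] fun _ => (1 : ℝ)) :
    ∃ Φ : A → A, IsSliceRegularOn (aroundSing Ω Ω₀ y) Φ ∧
      ∀ I ∈ imUnits A, ∀ z ∈ D, Φ (phi I z) = phi I (p z) * f (phi I z) := by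
  have hyE : profile re y ∈ E := (H.mem_sing_iff.1 hy).1
  -- This adds to `D` only the one or two points of the slice lying on `𝕊_y`.
  set E' : Set ℂ := {z | z ∈ D ∨ upperRep z = profile re y} with hE'
  have hE'E : E' ⊆ E := by
    rintro z (hz | hz)
    · exact H.subset hz
    · rwa [← upperRep_mem_iff H.stemDomain'.2.2, hz]
  have hED : ∀ z ∈ E', D ∈ 𝓝[≠] z := fun z hz => H.isolated z (hE'E hz)
  have hE'dom : IsStemDomain E' := by
    refine ⟨H.stemDomain.1.mono fun z hz => Or.inl hz, ?_, ?_⟩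
    · rw [isOpen_iff_mem_nhds]
      intro z hz
      refine Filter.mem_of_superset (insert_mem_nhds_iff.2 (hED z hz)) ?_
      rintro w (rfl | hw)
      exacts [hz, Or.inl hw]
    · rintro z (hz | hz)
      · exact Or.inl (H.stemDomain.2.2 z hz)
      · refine Or.inr (hz ▸ ?_)
        simp [upperRep]
  have hbd : ∀ z ∈ E', ∀ j,
      (fun w => p w * component b F j w) =O[𝓝[≠] z] fun _ => (1 : ℝ) := by
    rintro z (hz | hz) j
    · simpa using (((hp.continuous.tendsto z).mono_left nhdsWithin_le_nhds).isBigO_one ℝ).mul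
        (H.isBigO_of_mem hz j)
    · exact hb z hz j
  obtain ⟨G, Φ, hG, hΦ, hhol, -, -, hΦf⟩ := H.slice.exists_extension b H.stemDomain H.stem
    H.induces (fun j => (H.nash j).differentiableOn) hE'dom hED hp hpc hbd fun z hz => Or.inl hz
  refine ⟨Φ, ⟨E', G, hE'dom, ?_, hG, hΦ, hhol⟩, hΦf⟩
  ext x
  rw [H.slice.mem_circularised_iff H.nonempty hE'dom.2.2, aroundSing, H.sdiff_eq_circ,
    Set.mem_union, H.slice.mem_circularised_iff H.nonempty H.stemDomain.2.2,
    H.slice.mem_sph_iff H.nonempty]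
  simp [hE']

theorem isRemovable (H : IsSingularNash re Ω Ω₀ f D E F I b) {y : A} (hy : y ∈ Ω₀)
    (hb : ∀ z, upperRep z = profile re y → ∀ j,
      component b F j =O[𝓝[≠] z] fun _ => (1 : ℝ)) : IsRemovable (aroundSing Ω Ω₀ y) y f := by
  obtain ⟨Φ, hΦ, hΦf⟩ := H.exists_regular_extension hy (p := fun _ => 1)
    (differentiable_const _) (by simp) (by simpa using hb)
  refine ⟨Φ, hΦ, fun x hx => ?_⟩
  obtain ⟨J, hJ, z, hz, rfl⟩ := H.mem_aroundSing_sdiff hx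
  rw [hΦf J hJ z hz]
  simp [phi, H.slice.one_mul]

/-- At each of the at most two points above `𝕊_y`, every exponent at least the pole bound `m` works,
since `singStem` vanishes there. As "all large `k`" is stable under finite intersections, one `k ≥
1` serves both points and all components. -/
theorem exists_regular_mul (H : IsSingularNash re Ω Ω₀ f D E F I b) {y : A} (hy : y ∈ Ω₀) :
    ∃ k : ℕ, 1 ≤ k ∧ ∃ Φ : A → A, IsSliceRegularOn (aroundSing Ω Ω₀ y) Φ ∧
      ∀ x ∈ aroundSing Ω Ω₀ y \ sph y, Φ x = npowRec k (singFactor y x) * f x := by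
  set w₀ := profile re y with hw₀
  have hyE : w₀ ∈ E := (H.mem_sing_iff.1 hy).1
  have hev : ∀ z₀, upperRep z₀ = w₀ → ∀ j, ∀ᶠ k : ℕ in atTop,
      (fun w => singStem w₀ w ^ k * component b F j w) =O[𝓝[≠] z₀] fun _ => (1 : ℝ) := by
    intro z₀ hz₀ j
    have hz₀E : z₀ ∈ E := by rwa [← upperRep_mem_iff H.stemDomain'.2.2, hz₀]
    obtain ⟨m, hm⟩ := (H.nash j).exists_isBigO_sub_pow_mul H.stemDomain.2.1 H.stemDomain'.2.1
      H.isolated hz₀E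
    obtain ⟨q, hq, hqs⟩ := exists_singStem_eq w₀ z₀ hz₀
    filter_upwards [eventually_ge_atTop m] with k hk
    have hcont : Continuous fun w => q w ^ k * (w - z₀) ^ (k - m) := by fun_prop
    have h1 := (((hcont.tendsto z₀).mono_left
      (nhdsWithin_le_nhds (s := {z₀}ᶜ))).isBigO_one ℝ).mul hm
    simp only [_root_.mul_one] at h1
    refine h1.congr_left fun w => ?_
    rw [hqs, mul_pow, ← Nat.sub_add_cancel hk, pow_add (w - z₀), Nat.add_sub_cancel]
    ring
  have hev' : ∀ᶠ k : ℕ in atTop, ∀ z₀ ∈ ({w₀, conj w₀} : Set ℂ), upperRep z₀ = w₀ → ∀ j,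
      (fun w => singStem w₀ w ^ k * component b F j w) =O[𝓝[≠] z₀] fun _ => (1 : ℝ) := by
    refine (Set.Finite.eventually_all (Set.toFinite _)).2 fun z₀ _ => ?_
    by_cases hz₀ : upperRep z₀ = w₀
    · simpa only [hz₀, true_imp_iff] using eventually_all.2 (hev z₀ hz₀)
    · exact Eventually.of_forall fun k hk => absurd hk hz₀
  obtain ⟨k, hk, hk1⟩ := (hev'.and (eventually_ge_atTop 1)).exists
  obtain ⟨Φ, hΦ, hΦf⟩ := H.exists_regular_extension hy (p := fun z => singStem w₀ z ^ k)
    ((differentiable_singStem w₀).pow k) (fun z => by rw [singStem_conj, map_pow])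
    (fun z hz => hk z (by
      rcases upperRep_eq_or z with h | h
      · exact Or.inl (by rw [hw₀, ← hz, h])
      · exact Or.inr (by rw [Set.mem_singleton_iff, hw₀, ← hz, h, Complex.conj_conj])) hz)
  refine ⟨k, hk1, Φ, hΦ, fun x hx => ?_⟩
  obtain ⟨J, hJ, z, hz, rfl⟩ := H.mem_aroundSing_sdiff hx
  rw [hΦf J hJ z hz, H.slice.singFactor_phi H.nonempty y hJ, H.slice.npowRec_phi hJ]

theorem isSemiregular (H : IsSingularNash re Ω Ω₀ f D E F I b)
    (hf : IsSliceRegularOn (Ω \ Ω₀) f) : IsSemiregular Ω Ω₀ f := by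
  refine ⟨H.discrete, hf, fun y hy => or_iff_not_imp_left.2 fun hr => ⟨hr, ?_⟩⟩
  exact H.exists_regular_mul hy

/-- The regular extension of `δ_y ^ k f` is bounded near `𝕊_y`, which contradicts essentiality for
that same `k`. -/
theorem not_isEssential (H : IsSingularNash re Ω Ω₀ f D E F I b) {y : A} (hy : y ∈ Ω₀) :
    ¬ IsEssential (aroundSing Ω Ω₀ y) y f := by
  obtain ⟨k, -, Φ, hΦ, hΦf⟩ := H.exists_regular_mul hy
  have hyU : y ∈ aroundSing Ω Ω₀ y := Or.inr ((H.slice.mem_sph_iff H.nonempty).2 rfl)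
  obtain ⟨V, hV, hyV, hVU, M, hM⟩ := H.slice.exists_bound_near_sph H.nonempty hΦ hyU
  intro hess
  refine hess V hV hyV hVU k ⟨M, ?_⟩
  rintro _ ⟨x, hx, rfl⟩
  simp only [← hΦf x ⟨hVU hx.1, hx.2⟩]
  exact hM x hx.1

end IsSingularNash

end SliceNash
end

/-! ### Finiteness of the set of poles over a connected domain. -/

noncomputable section
namespace SliceNash

open Filter Asymptotics Polynomial
open scoped ComplexConjugate Topology Polynomial.Bivariate

variable {A : Type*} [NormedAddCommGroup A] [NormedSpace ℝ A] [Mul A] [One A] [Star A]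
  {re : A →ₗ[ℝ] ℝ}

open IsSliceAlgebra

/-- The union of the sets `α + β 𝕊_A` with `α + ι β` in a finite subset of the closed upper
half-plane. -/
theorem IsSliceAlgebra.exists_pointsAndSpheres (h : IsSliceAlgebra re)
    (hne : (imUnits A).Nonempty) {Z : Set ℂ} (hZ : Z.Finite) (hZ0 : ∀ z ∈ Z, 0 ≤ z.im) :
    ∃ Q X : Finset A, (∀ q ∈ Q, IsRealPoint q ∧ profile re q ∈ Z) ∧
      (∀ x ∈ X, ¬ IsRealPoint x ∧ profile re x ∈ Z) ∧
      ∀ x, x ∈ pointsAndSpheres Q X ↔ profile re x ∈ Z := by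
  classical
  obtain ⟨I, hI⟩ := hne
  have hprof : ∀ z ∈ Z, profile re (phi I z) = z := fun z hz =>
    h.profile_phi_of_nonneg hI (hZ0 z hz)
  have hQ : ∀ q ∈ (hZ.toFinset.filter fun z => z.im = 0).image (phi I),
      IsRealPoint q ∧ profile re q ∈ Z := by
    intro q hq
    simp only [Finset.mem_image, Finset.mem_filter, Set.Finite.mem_toFinset] at hq
    obtain ⟨z, ⟨hz, hz0⟩, rfl⟩ := hq
    rw [h.isRealPoint_iff, hprof z hz]
    exact ⟨hz0, hz⟩
  have hX : ∀ x ∈ (hZ.toFinset.filter fun z => z.im ≠ 0).image (phi I),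
      ¬ IsRealPoint x ∧ profile re x ∈ Z := by
    intro q hq
    simp only [Finset.mem_image, Finset.mem_filter, Set.Finite.mem_toFinset] at hq
    obtain ⟨z, ⟨hz, hz0⟩, rfl⟩ := hq
    rw [h.isRealPoint_iff, hprof z hz]
    exact ⟨hz0, hz⟩
  refine ⟨_, _, hQ, hX, fun x => ⟨?_, fun hx => ?_⟩⟩
  · rintro (hx | hx)
    · exact (hQ x hx).2
    · obtain ⟨y, hy, hxy⟩ := Set.mem_iUnion₂.1 hx
      rw [(h.mem_sph_iff ⟨I, hI⟩).1 hxy]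
      exact (hX y hy).2
  · have hxs : x ∈ sph (phi I (profile re x)) := by
      rw [h.mem_sph_iff ⟨I, hI⟩, hprof _ hx]
    by_cases h0 : (profile re x).im = 0
    · have hq : phi I (profile re x) ∈ (hZ.toFinset.filter fun z => z.im = 0).image (phi I) :=
        Finset.mem_image_of_mem _ (by simp [hx, h0])
      rw [h.sph_eq_singleton ⟨I, hI⟩ (hQ _ hq).1, Set.mem_singleton_iff] at hxs
      exact Or.inl (by rw [hxs]; exact hq)
    · exact Or.inr (Set.mem_iUnion₂.2 ⟨phi I (profile re x),
        Finset.mem_image_of_mem _ (by simp [hx, h0]), hxs⟩)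

theorem IsSliceAlgebra.sph_eq_sph (h : IsSliceAlgebra re) (hne : (imUnits A).Nonempty) {x y : A}
    (hxy : profile re x = profile re y) : sph x = sph y := by
  ext v; rw [h.mem_sph_iff hne, h.mem_sph_iff hne, hxy]

/-- Both `sph` and `singFactor` depend only on the profile. Hence the set of poles is a union of
full spheres. -/
theorem IsSliceAlgebra.isPole_iff (h : IsSliceAlgebra re) (hne : (imUnits A).Nonempty) {x y : A}
    (hxy : profile re x = profile re y) (U : Set A) (f : A → A) :
    IsPole U x f ↔ IsPole U y f := by
  have hs : ∀ v, singFactor x v = singFactor y v := fun v => by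
    obtain ⟨J, hJ, hv⟩ := h.exists_eq_phi_profile hne v
    rw [hv, h.singFactor_phi hne x hJ, h.singFactor_phi hne y hJ, hxy]
  simp only [IsPole, IsRemovable, h.sph_eq_sph hne hxy, hs]

namespace IsSingularNash

variable {u : ℕ} {Ω Ω₀ : Set A} {f : A → A} {D E : Set ℂ} {F : ℂ → A × A} {I : A}
  {b : Module.Basis (Fin (u + 1) × Fin 2) ℝ A}

/-- On a connected domain, each component of a stem-Nash function satisfies a single algebraic
equation. -/
theorem exists_evalEval_eq_zero (H : IsSingularNash re Ω Ω₀ f D E F I b) (hΩ : IsConnected Ω)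
    (j : Fin (u + 1) × Fin 2) :
    ∃ P : ℂ[X][Y], P ≠ 0 ∧ ∀ z ∈ E, ∀ᶠ w in 𝓝[≠] z, P.evalEval w (component b F j w) = 0 := by
  -- `E` may have two components exchanged by conjugation even when `Ω` is connected. The image of
  -- `Ω` under the profile is connected, and together with its conjugate it covers `E`.
  have hpre : IsPreconnected (profile re '' Ω) :=
    hΩ.isPreconnected.image _ H.slice.continuous_profile.continuousOn
  have hpre' : IsPreconnected (conj '' (profile re '' Ω)) :=
    hpre.image _ Complex.continuous_conj.continuousOn
  have hsub : ∀ z ∈ profile re '' Ω, z ∈ E := by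
    rintro _ ⟨x, hx, rfl⟩; exact H.mem_iff.1 hx
  have hsub' : ∀ z ∈ conj '' (profile re '' Ω), z ∈ E := by
    rintro _ ⟨z, hz, rfl⟩; exact H.stemDomain'.2.2 z (hsub z hz)
  have hcover : ∀ z ∈ E, upperRep z ∈ profile re '' Ω := fun z hz =>
    ⟨phi I z, H.mem_iff.2 (by
      rwa [H.slice.profile_phi H.mem_imUnits, upperRep_mem_iff H.stemDomain'.2.2]),
      H.slice.profile_phi H.mem_imUnits z⟩
  obtain ⟨z₁, hz₁⟩ := H.stemDomain.1
  have h1 := hcover z₁ (H.subset hz₁)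
  have h1D : upperRep z₁ ∈ D := (upperRep_mem_iff H.stemDomain.2.2).2 hz₁
  obtain ⟨P, hP, hPz⟩ := (H.nash j).exists_evalEval_eq_zero H.stemDomain.2.1
    (fun z hz => H.isolated z (hsub z hz)) hpre ⟨_, h1, h1D⟩
  obtain ⟨P', hP', hPz'⟩ := (H.nash j).exists_evalEval_eq_zero H.stemDomain.2.1
    (fun z hz => H.isolated z (hsub' z hz)) hpre'
    ⟨_, Set.mem_image_of_mem _ h1, H.stemDomain.2.2 _ h1D⟩
  -- The product vanishes wherever the relation of either half does.
  refine ⟨P * P', mul_ne_zero hP hP', fun z hz => ?_⟩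
  rcases upperRep_eq_or z with h | h
  · refine (hPz z (h ▸ hcover z hz)).mono fun w hw => ?_
    rw [evalEval_mul, hw, MulZeroClass.zero_mul]
  · refine (hPz' z ⟨_, hcover z hz, by rw [h, Complex.conj_conj]⟩).mono fun w hw => ?_
    rw [evalEval_mul, hw, MulZeroClass.mul_zero]

/-- A saturated subset of a discrete set of singularities which is relatively closed is
discrete. -/
theorem isDiscreteSingSet (H : IsSingularNash re Ω Ω₀ f D E F I b) {Ω₁ : Set A} (h₁ : Ω₁ ⊆ Ω₀)
    (hcl : IsClosed Ω₁) (hsat : ∀ y ∈ Ω₁, sph y ⊆ Ω₁) : IsDiscreteSingSet Ω Ω₁ := by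
  have hsub := h₁.trans H.discrete.1
  refine ⟨hsub, ⟨Ω₁, hcl, (Set.inter_eq_right.2 hsub).symm⟩, fun y hy => ⟨hsat y hy, ?_⟩⟩
  obtain ⟨-, V, hV, hVeq⟩ := H.discrete.2.2 y (h₁ hy)
  refine ⟨V, hV, Set.Subset.antisymm ?_ ?_⟩
  · rw [← hVeq]; exact Set.inter_subset_inter_right _ h₁
  · exact Set.subset_inter (hVeq ▸ Set.inter_subset_left) (hsat y hy)

/-- Away from the roots of the leading coefficients every component is locally bounded, so Riemann's
theorem removes the singularity. The finite set `Z` may still contain removable singularities, which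
semiregularity allows. -/
theorem exists_finite_extension (H : IsSingularNash re Ω Ω₀ f D E F I b) (hΩ : IsConnected Ω) :
    ∃ Z : Set ℂ, Z.Finite ∧ Z ⊆ E \ D ∧ (∀ z ∈ Z, 0 ≤ z.im) ∧
      (∀ y ∈ Ω₀, profile re y ∉ Z → IsRemovable (aroundSing Ω Ω₀ y) y f) ∧
      ∀ Ω₁ : Set A, (∀ x, x ∈ Ω₁ ↔ profile re x ∈ Z) → ∃ Φ : A → A,
        IsSliceNashOn (Ω \ Ω₁) Φ ∧ IsSemiregular Ω Ω₁ Φ ∧ ∀ x ∈ Ω \ Ω₀, f x = Φ x := by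
  choose P hP hPz using H.exists_evalEval_eq_zero hΩ
  set a : ℂ[X] := ∏ j, (P j).leadingCoeff with ha
  have ha0 : a ≠ 0 := Finset.prod_ne_zero_iff.2 fun j _ => leadingCoeff_ne_zero.2 (hP j)
  have hbound : ∀ z ∈ E, a.eval z ≠ 0 → ∀ j, component b F j =O[𝓝[≠] z] fun _ => (1 : ℝ) := by
    intro z hz haz j
    have hj : (P j).leadingCoeff.eval z ≠ 0 := by
      rw [ha, eval_prod] at haz
      exact Finset.prod_ne_zero_iff.1 haz j (Finset.mem_univ j)
    have h1 := isBigO_leadingCoeff_mul nhdsWithin_le_nhds (hPz j z hz)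
    have h2 := ((((P j).leadingCoeff.continuous.tendsto z).inv₀ hj).mono_left
      (nhdsWithin_le_nhds (s := {z}ᶜ))).isBigO_one ℝ |>.mul h1
    simp only [_root_.mul_one] at h2
    refine h2.congr' ?_ EventuallyEq.rfl
    filter_upwards [nhdsWithin_le_nhds
      ((P j).leadingCoeff.continuous.continuousAt.eventually_ne hj)] with w hw
    rw [inv_mul_cancel_left₀ hw]
  -- A sphere is recorded by its point in the closed upper half-plane, but a component may blow up
  -- at that point or at its conjugate, so both are tested.
  set Z : Set ℂ := {z | z ∈ E \ D ∧ 0 ≤ z.im ∧ (a.eval z = 0 ∨ a.eval (conj z) = 0)} with hZdef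
  have hroots : {z : ℂ | a.eval z = 0}.Finite := by
    refine (a.roots.toFinset.finite_toSet).subset fun z hz => ?_
    simpa [ha0] using hz
  have hZ : Z.Finite := by
    refine (hroots.union (hroots.preimage (starRingEnd ℂ).injective.injOn)).subset ?_
    rintro z ⟨-, -, hz | hz⟩
    exacts [Or.inl hz, Or.inr hz]
  have hout : ∀ z ∈ E, upperRep z ∉ Z → ∀ j,
      component b F j =O[𝓝[≠] z] fun _ => (1 : ℝ) := by
    intro z hz hzZ j
    by_cases hzD : z ∈ D
    · exact H.isBigO_of_mem hzD j
    refine hbound z hz (fun hz0 => hzZ ⟨⟨?_, ?_⟩, abs_nonneg _, ?_⟩) j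
    · rwa [upperRep_mem_iff H.stemDomain'.2.2]
    · rwa [upperRep_mem_iff H.stemDomain.2.2]
    · rcases upperRep_eq_or z with h | h <;> rw [h]
      · exact Or.inl hz0
      · exact Or.inr (by rwa [Complex.conj_conj])
  refine ⟨Z, hZ, fun z hz => hz.1, fun z hz => hz.2.1, fun y hy hyZ => ?_, fun Ω₁ hΩ₁ => ?_⟩
  · refine H.isRemovable hy fun z hz j => hout z ?_ (by rwa [hz]) j
    rw [← upperRep_mem_iff H.stemDomain'.2.2, hz]
    exact (H.mem_sing_iff.1 hy).1
  set E₁ : Set ℂ := {z | z ∈ E ∧ upperRep z ∉ Z} with hE₁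
  have hup : Continuous upperRep := by
    have : upperRep = fun z => (z.re : ℂ) + (|z.im| : ℝ) * Complex.I := by
      funext z; apply Complex.ext <;> simp [upperRep]
    rw [this]; fun_prop
  have hDE₁ : D ⊆ E₁ := fun z hz =>
    ⟨H.subset hz, fun h => h.1.2 ((upperRep_mem_iff H.stemDomain.2.2).2 hz)⟩
  have hE₁dom : IsStemDomain E₁ := by
    refine ⟨H.stemDomain.1.mono hDE₁,
      H.stemDomain'.2.1.inter (hZ.isClosed.preimage hup).isOpen_compl, ?_⟩
    rintro z ⟨hz, hz'⟩
    refine ⟨H.stemDomain'.2.2 z hz, ?_⟩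
    have : upperRep (conj z) = upperRep z := by simp [upperRep]
    rwa [this]
  have hiso : ∀ z ∈ E₁, D ∈ 𝓝[≠] z := fun z hz => H.isolated z hz.1
  obtain ⟨G, Φ, hG, hΦ, hhol, hGd, hGt, hΦf⟩ := H.slice.exists_extension b H.stemDomain H.stem
    H.induces (fun j => (H.nash j).differentiableOn) hE₁dom hiso (p := fun _ => 1)
    (differentiable_const _) (by simp) (by simpa using fun z hz => hout z hz.1 hz.2) hDE₁
  have hsd : Ω \ Ω₁ = circularised E₁ := by
    ext x
    rw [H.slice.mem_circularised_iff H.nonempty hE₁dom.2.2, Set.mem_sdiff, hΩ₁, H.mem_iff]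
    simp [hE₁]
  -- The global relation `P j` certifies the Nash property on all of `E₁` at once.
  have hnash : ∀ j, IsComplexNashOn E₁ (component b G j) := fun j z hz =>
    ⟨E₁, hE₁dom.2.1, hz, subset_rfl, (hGd j).analyticOnNhd hE₁dom.2.1, P j, hP j, fun w hw =>
      evalEval_eq_zero_of_tendsto (hPz j w hw.1) (by simpa using hGt j w hw)⟩
  have hdisc : IsDiscreteSingSet Ω Ω₁ := by
    refine H.isDiscreteSingSet (fun x hx => H.mem_sing_iff.2 ((hΩ₁ x).1 hx).1) ?_
      fun y hy x hx => ?_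
    · have : Ω₁ = profile re ⁻¹' Z := Set.ext hΩ₁
      rw [this]
      exact hZ.isClosed.preimage H.slice.continuous_profile
    · rw [hΩ₁, (H.slice.mem_sph_iff H.nonempty).1 hx]
      exact (hΩ₁ y).1 hy
  -- `Φ` with singular set `Ω₁` is again in the original situation, so the local result gives its
  -- semiregularity.
  have H₁ : IsSingularNash re Ω Ω₁ Φ E₁ E G I b :=
    ⟨H.slice, hdisc, hE₁dom, H.stemDomain', H.eq_circ, hsd, fun z hz => hz.1,
      fun z hz => mem_of_superset (H.isolated z hz) hDE₁, hG, hΦ, H.mem_imUnits, H.splitting,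
      hnash⟩
  refine ⟨Φ, ⟨E₁, G, hE₁dom, hsd, hG, hΦ, hhol, I, H.mem_imUnits, u, b, H.splitting, hnash⟩,
    H₁.isSemiregular ⟨E₁, G, hE₁dom, hsd, hG, hΦ, hhol⟩, fun x hx => ?_⟩
  rw [H.sdiff_eq_circ] at hx
  obtain ⟨J, hJ, z, hz, rfl⟩ := hx
  rw [hΦf J hJ z hz]
  simp [phi, H.slice.one_mul]

end IsSingularNash

end SliceNash
end

theorem lemma6p7 {A : Type*} [NormedAddCommGroup A] [NormedSpace ℝ A] [Mul A] [One A] [Star A]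
    (hA : SliceNash.IsQuaternionsOrOctonions A)
    (Ω Ω₀ : Set A) (hΩ_open : IsOpen Ω) (hΩ_circ : SliceNash.IsCircular Ω)
    (hΩ₀ : SliceNash.IsDiscreteSingSet Ω Ω₀)
    (f : A → A) (hf : SliceNash.IsSliceNashOn (Ω \ Ω₀) f) :
    SliceNash.IsSemiregular Ω Ω₀ f ∧
    (∀ y ∈ Ω₀, ¬ SliceNash.IsEssential (SliceNash.aroundSing Ω Ω₀ y) y f) ∧
    (IsConnected Ω →
      (∃ (Q X : Finset A) (Φ : A → A),
        (∀ q ∈ Q, q ∈ Ω₀ ∧ SliceNash.IsRealPoint q) ∧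
        (∀ x ∈ X, SliceNash.sph x ⊆ Ω₀ ∧ ¬ SliceNash.IsRealPoint x) ∧
        SliceNash.IsSliceNashOn (Ω \ SliceNash.pointsAndSpheres Q X) Φ ∧
        SliceNash.IsSemiregular Ω (SliceNash.pointsAndSpheres Q X) Φ ∧
        ∀ x ∈ Ω \ Ω₀, f x = Φ x) ∧
      (∃ Q X : Finset A,
        (∀ q ∈ Q, SliceNash.IsRealPoint q) ∧
        (∀ x ∈ X, ¬ SliceNash.IsRealPoint x) ∧
        SliceNash.poles Ω Ω₀ f = SliceNash.pointsAndSpheres Q X)) := by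
  obtain ⟨⟨re, h⟩, hne⟩ := hA.exists_isSliceAlgebra
  obtain ⟨u, D, E, F, I, b, H⟩ := SliceNash.exists_isSingularNash h hΩ_open hΩ_circ hΩ₀ hf
  have hreg : SliceNash.IsSliceRegularOn (Ω \ Ω₀) f := by
    obtain ⟨D', F', h1, h2, h3, h4, h5, -⟩ := hf
    exact ⟨D', F', h1, h2, h3, h4, h5⟩
  refine ⟨H.isSemiregular hreg, fun y hy => H.not_isEssential hy, fun hΩ => ?_⟩
  obtain ⟨Z, hZ, hZsub, hZ0, hrem, hext⟩ := H.exists_finite_extension hΩ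
  constructor
  · obtain ⟨Q, X, hQ, hX, hQX⟩ := h.exists_pointsAndSpheres hne hZ hZ0
    obtain ⟨Φ, hΦ, hsemi, hfΦ⟩ := hext _ hQX
    exact ⟨Q, X, Φ, fun q hq => ⟨H.mem_sing_iff.2 (hZsub (hQ q hq).2), (hQ q hq).1⟩,
      fun x hx => ⟨(hΩ₀.2.2 x (H.mem_sing_iff.2 (hZsub (hX x hx).2))).1, (hX x hx).1⟩,
      hΦ, hsemi, hfΦ⟩
  · have hpoles : SliceNash.IsSliceAlgebra.profile re '' SliceNash.poles Ω Ω₀ f ⊆ Z := by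
      rintro _ ⟨y, hy, rfl⟩
      by_contra h0
      exact hy.2.1 (hrem y hy.1 h0)
    obtain ⟨Q, X, hQ, hX, hQX⟩ := h.exists_pointsAndSpheres hne (hZ.subset hpoles)
      fun z hz => hZ0 z (hpoles hz)
    refine ⟨Q, X, fun q hq => (hQ q hq).1, fun x hx => (hX x hx).1, Set.ext fun x => ?_⟩
    rw [hQX]
    refine ⟨Set.mem_image_of_mem _, ?_⟩
    -- A point with the same profile as a pole lies on the same sphere, hence in `Ω₀`, and is a pole
    -- as well.
    rintro ⟨y, hy, hyx⟩
    refine ⟨(hΩ₀.2.2 y hy.1).1 ((h.mem_sph_iff hne).2 hyx.symm), ?_⟩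
    rw [h.isPole_iff hne hyx.symm, SliceNash.aroundSing, h.sph_eq_sph hne hyx.symm]
    exact hy.2
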